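/- Fix $K\ge 0$ and consider, for each sample size $T$, a probability space carrying random variables $Y_t,C_t,\hat C_t,u_t$ ($1\le t\le T$) and a vector $\rho=(\rho_1,\dots,\rho_K)'\in\mathbb R^K$; all of these, and the last pre-treatment period $T_0\ge K$, may depend on $T$, and limits are taken as $T\to\infty$. Put $\varepsilon_t=Y_t-C_t$, $\hat\varepsilon_t=Y_t-\hat C_t$, $x_t=(\varepsilon_{t-1},\dots,\varepsilon_{t-K})'$, $\hat x_t=(\hat\varepsilon_{t-1},\dots,\hat\varepsilon_{t-K})'$, and suppose that $\varepsilon_t=x_t'\rho+u_t$ for $K+1\le t\le T$, where $\{\varepsilon_t\}_{t=1}^T$ is strictly stationary for each $T$ or, more generally, $\varepsilon_1,\dots,\varepsilon_K=O_P(1)$. Let \[ \hat\rho=\Big(\sum_{t=K+1}^T\hat x_t\hat x_t'\Big)^{-1}\sum_{t=K+1}^T\hat x_t\hat\varepsilon_t,\qquad P_t=C_t+x_t'\rho,\qquad \hat P_t=\hat C_t+\hat x_t'\hat\rho . \] Suppose that for each $T$ the innovations $u_1,\dots,u_T$ are i.i.d. with $E(u_t)=0$, that $E(u_1^4)$ is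 bounded and $E(u_1^2)$ is bounded away from zero, uniformly in $T$, and that for some $c>0$ not depending on $T$ all complex roots $z$ of $1-\sum_{j=1}^K\rho_jz^j=0$ satisfy $|z|\ge 1+c$. Assume that (1) $\sum_{t=1}^T(\hat C_t-C_t)^2=o_P(T)$, and (2) $\hat C_t-C_t=o_P(1)$ for $T_0-K+1\le t\le T$. Then $\hat P_t-P_t=o_P(1)$ for $T_0+1\le t\le T$, and \[ \sum_{t=K+1}^T(\hat P_t-P_t)^2=o_P(T). \] Here a pointwise statement for $a\le t\le b$, with bounds depending on $T$, means that it holds for every sequence $t=t_T$ with $a\le t_T\le b$ (when $T-T_0$ is fixed: for each fixed distance from the end of the sample). -/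

import Mathlib

open MeasureTheory ProbabilityTheory Filter Topology Finset Matrix
open scoped ENNReal

namespace FusedAR

/-- `X_T = o_P(a_T)` as `T → ∞`, for a sequence of random variables `X_T`, each living on its own
probability space (`a_T > 0` for large `T`). -/
def IsLittleOP {Ω : ℕ → Type*} [∀ T, MeasurableSpace (Ω T)] (P : ∀ T, Measure (Ω T))
    (X : ∀ T, Ω T → ℝ) (a : ℕ → ℝ) : Prop :=
  ∀ c : ℝ, 0 < c → Tendsto (fun T => P T {ω | c * a T < |X T ω|}) atTop (𝓝 0)

/-- `X_T = O_P(1)` as `T → ∞`. -/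
def IsBoundedInProb {Ω : ℕ → Type*} [∀ T, MeasurableSpace (Ω T)] (P : ∀ T, Measure (Ω T))
    (X : ∀ T, Ω T → ℝ) : Prop :=
  ∀ η : ℝ, 0 < η → ∃ M : ℝ, ∀ᶠ T in atTop, P T {ω | M < |X T ω|} ≤ ENNReal.ofReal η

/-- The series `e_1, …, e_T` is strictly stationary: for all `m` and `h` with `m + h ≤ T`, the
vectors `(e_{1+h}, …, e_{m+h})` and `(e_1, …, e_m)` have the same law. -/
def IsStationaryUpTo {Ω : Type*} [MeasurableSpace Ω] (μ : Measure Ω) (T : ℕ)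
    (e : ℕ → Ω → ℝ) : Prop :=
  ∀ m h : ℕ, m + h ≤ T →
    IdentDistrib (fun ω (i : Fin m) => e (i + 1 + h) ω) (fun ω (i : Fin m) => e (i + 1) ω) μ μ

/-- The vector of lags `x_t = (e_{t-1}, e_{t-2}, …, e_{t-K})'`; it is only used for `t ≥ K + 1`. -/
def lagVec (K : ℕ) (e : ℕ → ℝ) (t : ℕ) : Fin K → ℝ := fun j => e (t - (j + 1))

/-- The least squares fit of an autoregression of order `K` to `e_1, …, e_T`:
`(∑_{t=K+1}^T x_t x_t')⁻¹ (∑_{t=K+1}^T x_t e_t)`. -/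
noncomputable def olsAR (K T : ℕ) (e : ℕ → ℝ) : Fin K → ℝ :=
  (∑ t ∈ Icc (K + 1) T, vecMulVec (lagVec K e t) (lagVec K e t))⁻¹ *ᵥ
    (∑ t ∈ Icc (K + 1) T, e t • lagVec K e t)

/-- The counterfactual mean proxy `P_t = C_t + x_t' ρ`, where `x_t` is the vector of lags of the
residuals `Y_t - C_t`. -/
noncomputable def proxy {K : ℕ} (Y C : ℕ → ℝ) (ρ : Fin K → ℝ) (t : ℕ) : ℝ :=
  C t + lagVec K (fun s => Y s - C s) t ⬝ᵥ ρ

/-- The two-stage estimate `P̂_t = Ĉ_t + x̂_t' ρ̂`, where `ρ̂` is the least squares fit of an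
autoregression to the estimated residuals `Y_t - Ĉ_t`, `1 ≤ t ≤ T`. -/
noncomputable def proxyHat (K T : ℕ) (Y Chat : ℕ → ℝ) (t : ℕ) : ℝ :=
  proxy Y Chat (olsAR K T (fun s => Y s - Chat s)) t

end FusedAR

/-! Write `δ = Ĉ - C` and `e = Y - C`. The error `P̂_t - P_t` splits exactly into `δ_t - ∑ ρ_j
δ_{t-j}` and `x̂_t'(ρ̂ - ρ)` (`proxyHat_sub_proxy`). The first part is a bounded filter of `δ`,
which the assumptions on the first stage control. For the second, it suffices that `ρ̂ - ρ` is
negligible and that `e` is bounded in probability, pointwise and in mean square.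

Since `ρ` and the law of `e` vary with `T`, every bound must be uniform. The root condition gives
geometric decay with constants depending only on `K` and `c` (`exists_uniform_stability`), so `e` is
a moving average of `u` with geometric weights plus a decaying effect of the initial values
(`exists_movingAverage`). The moving average has bounded second moments. In the stationary case,
tightness of the initial values has to be proved: shifting time damps their influence by a fixed
factor, and comparing laws bounds the tail at level `B` by the tail at `2B` plus a Chebyshev term
(`tail_le_of_stationary`, `le_of_doubling`).

Consistency of `ρ̂` (`isLittleOP_sum_sq_olsAR_sub`) avoids the limit of the sample covariance
matrix. The autoregressive filter sends `x_t'v` to `∑ v_i u_{t-i}` and is bounded in mean square, so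
the near orthogonality of the noise bounds the Gram matrix below (`gram_lower_bound`). The normal
equations involve `∑ x_t u_t`, which is `o_P(T)` by orthogonality of products of innovations.
Replacing `e` by `e - δ` changes either sum by `o_P(T)`, by Cauchy-Schwarz. -/

namespace FusedAR

/-! ### Uniform geometric stability of linear recursions. -/

section Stability

open Polynomial

/-- The shift operator on complex sequences. -/
def shift : Module.End ℂ (ℕ → ℂ) := LinearMap.funLeft ℂ ℂ Nat.succ

lemma shift_apply (a : ℕ → ℂ) (n : ℕ) : shift a n = a (n + 1) := rfl

lemma shift_pow_apply (k : ℕ) (a : ℕ → ℂ) (n : ℕ) : (shift ^ k) a n = a (n + k) := by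
  induction k generalizing n with
  | zero => simp
  | succ k ih =>
    rw [pow_succ', Module.End.mul_apply, shift_apply, ih]
    congr 1
    omega

/-- A geometric bound for a first-order recursion with geometrically decaying input. -/
lemma norm_le_of_first_order {r s B D : ℝ} (hr : 0 ≤ r) (hrs : r < s) {l : ℂ} (hl : ‖l‖ ≤ r)
    {a b : ℕ → ℂ} (hab : ∀ n, a (n + 1) = l * a n + b n) (hb : ∀ n, ‖b n‖ ≤ B * s ^ n)
    (h0 : ‖a 0‖ ≤ D) (hD : B ≤ D * (s - r)) (n : ℕ) : ‖a n‖ ≤ D * s ^ n := by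
  induction n with
  | zero => simpa using h0
  | succ n ih =>
    have hs : 0 < s := hr.trans_lt hrs
    have h1 : ‖a (n + 1)‖ ≤ r * (D * s ^ n) + B * s ^ n := by
      rw [hab]
      refine (norm_add_le _ _).trans (add_le_add ?_ (hb n))
      rw [norm_mul]
      gcongr
    have h2 : B * s ^ n ≤ D * (s - r) * s ^ n := by gcongr
    calc _ ≤ _ := h1
      _ ≤ r * (D * s ^ n) + D * (s - r) * s ^ n := by gcongr
      _ = _ := by ring

/-- Sequences annihilated by a product of `k` factors `shift - l` with `‖l‖ ≤ r` decay
geometrically, uniformly in the factors. -/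
lemma exists_bound_of_aeval_prod_eq_zero {r s : ℝ} (hr : 0 ≤ r) (hrs : r < s) (hs : s ≤ 1)
    (k : ℕ) : ∃ A : ℝ, 0 ≤ A ∧ ∀ L : Multiset ℂ, L.card = k → (∀ l ∈ L, ‖l‖ ≤ r) →
      ∀ a : ℕ → ℂ, aeval shift (L.map fun l => X - C l).prod a = 0 →
      ∀ M : ℝ, 0 ≤ M → (∀ i < k, ‖a i‖ ≤ M) → ∀ n, ‖a n‖ ≤ A * M * s ^ n := by
  have hs0 : 0 < s := hr.trans_lt hrs
  have hd : 0 < s - r := sub_pos.2 hrs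
  induction k with
  | zero =>
    refine ⟨0, le_rfl, fun L hL _ a ha M _ _ n => ?_⟩
    rw [Multiset.card_eq_zero] at hL
    subst hL
    have : a = 0 := by simpa using ha
    simp [this]
  | succ k ih =>
    obtain ⟨A, hA, H⟩ := ih
    -- The first summand absorbs an input of size `2 * A * M * s ^ n` in the first-order recursion;
    -- the `1` covers the initial value.
    refine ⟨A * 2 / (s - r) + 1, by positivity, fun L hL hroot a ha M hM hinit => ?_⟩
    obtain ⟨l, L', rfl⟩ := Multiset.card_pos_iff_exists_mem.1 (by omega : 0 < L.card) |>.imp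
      fun l hl => Multiset.exists_cons_of_mem hl
    have hl : ‖l‖ ≤ r := hroot l (Multiset.mem_cons_self _ _)
    -- Peeling off one factor: `b` is annihilated by the remaining ones, and `a` is recovered from
    -- `b` by a first-order recursion.
    set b : ℕ → ℂ := fun n => a (n + 1) - l * a n with hb
    have hba : aeval shift (X - C l) a = b := by
      ext n
      simp [hb, shift_apply, Algebra.algebraMap_eq_smul_one]
    have hb0 : aeval shift (L'.map fun l => X - C l).prod b = 0 := by
      rw [← hba, ← Module.End.mul_apply, ← map_mul, mul_comm]
      simpa using ha
    have hbi : ∀ i < k, ‖b i‖ ≤ 2 * M := fun i hi => by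
      refine (norm_sub_le _ _).trans ?_
      rw [norm_mul]
      have h1 := hinit (i + 1) (by omega)
      have h2 := hinit i (by omega)
      have h3 : ‖l‖ * ‖a i‖ ≤ 1 * M := by
        gcongr
        linarith
      linarith
    have hbn := H L' (by simpa using hL) (fun l hl => hroot l (Multiset.mem_cons_of_mem hl)) b hb0
      (2 * M) (by positivity) hbi
    refine norm_le_of_first_order hr hrs hl (b := b) (fun n => by simp [hb]) hbn ?_ ?_
    · have := hinit 0 (by omega)
      have : 0 ≤ A * 2 / (s - r) * M := by positivity
      linarith
    · have : (A * 2 / (s - r) + 1) * M * (s - r) = A * (2 * M) + M * (s - r) := by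
        field_simp
      rw [this]
      have : 0 ≤ M * (s - r) := by positivity
      linarith

/-- The characteristic polynomial `X^K - ∑ ρ_j X^(K-1-j)` of an autoregression. -/
noncomputable def arPoly {K : ℕ} (ρ : Fin K → ℝ) : ℂ[X] :=
  X ^ K + -∑ j : Fin K, C (ρ j : ℂ) * X ^ (K - 1 - j : ℕ)

lemma degree_lower_lt {K : ℕ} (ρ : Fin K → ℝ) :
    degree (-∑ j : Fin K, C (ρ j : ℂ) * X ^ (K - 1 - j : ℕ) : ℂ[X]) < K := by
  rw [degree_neg]
  refine (degree_sum_le _ _).trans_lt ?_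
  rw [Finset.sup_lt_iff (by exact_mod_cast WithBot.bot_lt_coe K)]
  intro j _
  refine (degree_C_mul_X_pow_le _ _).trans_lt ?_
  have := j.2
  exact_mod_cast (by omega : K - 1 - (j : ℕ) < K)

lemma monic_arPoly {K : ℕ} (ρ : Fin K → ℝ) : (arPoly ρ).Monic :=
  monic_X_pow_add (degree_lower_lt ρ)

lemma natDegree_arPoly {K : ℕ} (ρ : Fin K → ℝ) : (arPoly ρ).natDegree = K := by
  have h : (arPoly ρ).degree = (X ^ K : ℂ[X]).degree :=
    degree_add_eq_left_of_degree_lt (by rw [degree_X_pow]; exact degree_lower_lt ρ)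
  rw [degree_X_pow] at h
  exact natDegree_eq_of_degree_eq_some h

lemma coeff_arPoly {K : ℕ} (ρ : Fin K → ℝ) (j : Fin K) :
    (arPoly ρ).coeff (K - 1 - j) = -(ρ j : ℂ) := by
  have hj := j.2
  simp only [arPoly, coeff_add, coeff_X_pow, coeff_neg, finsetSum_coeff, coeff_C_mul]
  rw [if_neg (by omega), Finset.sum_eq_single j]
  · simp
  · intro i _ hij
    have hi := i.2
    rw [if_neg, mul_zero]
    intro h
    exact hij (Fin.ext (by omega))
  · simp

/-- Nonzero roots of the characteristic polynomial are reciprocals of roots of `1 - ∑ ρ_j z^j`. The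
root `0`, which occurs when the last coefficient vanishes, has no reciprocal and is treated apart.
-/
lemma norm_root_le {K : ℕ} {ρ : Fin K → ℝ} {c : ℝ} (hc : 0 < c)
    (h : ∀ z : ℂ, 1 - ∑ j : Fin K, (ρ j : ℂ) * z ^ ((j : ℕ) + 1) = 0 → 1 + c ≤ ‖z‖)
    {l : ℂ} (hl : l ∈ (arPoly ρ).roots) : ‖l‖ ≤ (1 + c)⁻¹ := by
  by_cases h0 : l = 0
  · subst h0
    simp only [norm_zero]
    positivity
  have he : (arPoly ρ).eval l = 0 := (mem_roots'.1 hl).2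
  have h1 := h l⁻¹ (by
    have h2 : l ^ K * (1 - ∑ j : Fin K, (ρ j : ℂ) * l⁻¹ ^ ((j : ℕ) + 1)) = (arPoly ρ).eval l := by
      rw [mul_sub, mul_one, Finset.mul_sum, sub_eq_add_neg]
      simp only [arPoly, eval_add, eval_pow, eval_X, eval_neg, eval_finsetSum, eval_mul, eval_C]
      congr 2
      refine Finset.sum_congr rfl fun j _ => ?_
      have h3 : l ^ K = l ^ (K - 1 - j : ℕ) * l ^ ((j : ℕ) + 1) := by
        rw [← pow_add]
        congr 1
        omega
      rw [h3, inv_pow]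
      field_simp
    rw [he] at h2
    exact (mul_eq_zero.1 h2).resolve_left (pow_ne_zero _ h0))
  rw [norm_inv] at h1
  rw [← inv_inv ‖l‖]
  exact inv_anti₀ (by positivity) h1

/-- Uniform geometric stability of autoregressions whose roots are bounded away from the unit
disc, together with a uniform bound for the coefficients. -/
theorem exists_uniform_stability (K : ℕ) {c : ℝ} (hc : 0 < c) :
    ∃ A s : ℝ, 1 ≤ A ∧ 0 < s ∧ s < 1 ∧ ∀ ρ : Fin K → ℝ,
      (∀ z : ℂ, 1 - ∑ j : Fin K, (ρ j : ℂ) * z ^ ((j : ℕ) + 1) = 0 → 1 + c ≤ ‖z‖) →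
      (∀ j, |ρ j| ≤ A) ∧
      ∀ a : ℕ → ℝ, (∀ n, a (n + K) = ∑ j : Fin K, ρ j * a (n + (K - 1 - j))) →
        ∀ M : ℝ, 0 ≤ M → (∀ i < K, |a i| ≤ M) → ∀ n, |a n| ≤ A * M * s ^ n := by
  set r : ℝ := (1 + c)⁻¹ with hr
  have hr0 : 0 < r := by positivity
  have hr1 : r < 1 := inv_lt_one_of_one_lt₀ (by linarith)
  obtain ⟨A, hA, H⟩ := exists_bound_of_aeval_prod_eq_zero hr0.le
    (show r < (r + 1) / 2 by linarith) (by linarith) K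
  -- The rate lies midway between `r` and `1`. The summand `2 ^ K` dominates the binomial bound for
  -- the coefficients of a monic polynomial with roots in the unit disc, and makes the constant at
  -- least `1`.
  refine ⟨A + 2 ^ K, (r + 1) / 2, ?_, by linarith, by linarith, fun ρ hρ => ⟨fun j => ?_, ?_⟩⟩
  · have : (1 : ℝ) ≤ 2 ^ K := one_le_pow₀ (by norm_num)
    linarith
  · have h1 := coeff_le_of_roots_le (p := arPoly ρ) (f := RingHom.id ℂ) (B := 1) (K - 1 - j)
      (monic_arPoly ρ) (IsAlgClosed.splits _) (fun z hz => by
        rw [Polynomial.map_id] at hz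
        exact (norm_root_le hc hρ hz).trans hr1.le)
    rw [Polynomial.map_id, coeff_arPoly, norm_neg, Complex.norm_real, Real.norm_eq_abs, one_pow,
      one_mul, natDegree_arPoly] at h1
    have h2 : (K.choose (K - 1 - j) : ℝ) ≤ 2 ^ K := by exact_mod_cast Nat.choose_le_two_pow _ _
    linarith
  · intro a ha M hM hinit n
    have hprod : ((arPoly ρ).roots.map fun l => X - C l).prod = arPoly ρ :=
      (prod_multiset_X_sub_C_of_monic_of_roots_card_eq (monic_arPoly ρ)
        (IsAlgClosed.card_roots_eq_natDegree))
    have h1 := H (arPoly ρ).roots (by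
      rw [IsAlgClosed.card_roots_eq_natDegree, natDegree_arPoly])
      (fun l hl => norm_root_le hc hρ hl) (fun n => (a n : ℂ)) (by
        rw [hprod]
        ext n
        simp only [arPoly, map_add, map_neg, map_sum, map_mul, map_pow, aeval_X, aeval_C,
          LinearMap.add_apply, LinearMap.neg_apply, LinearMap.sum_apply, Module.End.mul_apply,
          Pi.add_apply, Pi.neg_apply, Finset.sum_apply, Algebra.algebraMap_eq_smul_one,
          LinearMap.smul_apply, Module.End.one_apply, Pi.smul_apply, shift_pow_apply, smul_eq_mul,
          Pi.zero_apply]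
        rw [ha]
        push_cast
        ring) M hM (by simpa using hinit) n
    simp only [Complex.norm_real, Real.norm_eq_abs] at h1
    refine h1.trans ?_
    have : (0 : ℝ) ≤ 2 ^ K := by positivity
    gcongr
    linarith

end Stability

/-! ### Moving average representation. -/

section Decomposition

/-- The response of an autoregression of order `K`, started at zero, to a unit impulse at
time `K`. -/
noncomputable def impulse {K : ℕ} (ρ : Fin K → ℝ) (m : ℕ) : ℝ :=
  if m < K then 0 else if m = K then 1 else ∑ j : Fin K, ρ j * impulse ρ (m - 1 - j)
termination_by m
decreasing_by omega

lemma impulse_of_lt {K : ℕ} (ρ : Fin K → ℝ) {m : ℕ} (h : m < K) : impulse ρ m = 0 := by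
  rw [impulse, if_pos h]

lemma impulse_self {K : ℕ} (ρ : Fin K → ℝ) : impulse ρ K = 1 := by
  rw [impulse, if_neg (lt_irrefl K), if_pos rfl]

lemma impulse_of_gt {K : ℕ} (ρ : Fin K → ℝ) {m : ℕ} (h : K < m) :
    impulse ρ m = ∑ j : Fin K, ρ j * impulse ρ (m - 1 - j) := by
  rw [impulse, if_neg (by omega), if_neg (by omega)]

/-- The convolution of the impulse response with an input `w`. -/
noncomputable def response {K : ℕ} (ρ : Fin K → ℝ) (w : ℕ → ℝ) (m : ℕ) : ℝ :=
  ∑ n ∈ range (m + 1 - K), impulse ρ (m - n) * w n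

lemma response_of_lt {K : ℕ} (ρ : Fin K → ℝ) (w : ℕ → ℝ) {m : ℕ} (h : m < K) :
    response ρ w m = 0 := by
  rw [response, (by omega : m + 1 - K = 0), range_zero, sum_empty]

/-- Superposition: past inputs evolve by the homogeneous recursion of the impulse response, and the
newest input enters with weight `impulse ρ K = 1`. -/
lemma response_add {K : ℕ} (ρ : Fin K → ℝ) (w : ℕ → ℝ) (n : ℕ) :
    response ρ w (n + K) = ∑ j : Fin K, ρ j * response ρ w (n + (K - 1 - j)) + w n := by
  -- All lagged responses are put on the common range `n`; the added terms vanish because the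
  -- impulse response is zero before time `K`.
  have h1 : ∀ j : Fin K, response ρ w (n + (K - 1 - j)) =
      ∑ i ∈ range n, impulse ρ (n + (K - 1 - j) - i) * w i := fun j => by
    have hj := j.2
    refine sum_subset (fun i hi => ?_) (fun i hi hi' => ?_)
    · simp only [mem_range] at *
      omega
    · simp only [mem_range] at *
      rw [impulse_of_lt ρ (by omega), zero_mul]
  simp_rw [h1, response, mul_sum]
  rw [(by omega : n + K + 1 - K = n + 1), sum_range_succ, Nat.add_sub_cancel_left, impulse_self,
    one_mul, sum_comm]
  congr 1
  refine sum_congr rfl fun i hi => ?_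
  simp only [mem_range] at hi
  rw [impulse_of_gt ρ (by omega), sum_mul]
  refine sum_congr rfl fun j _ => ?_
  have hj := j.2
  rw [mul_assoc]
  congr 3
  omega

/-- Uniformly over autoregressions with roots bounded away from the unit disc, the series is a
moving average of its innovations, with geometrically decaying weights, up to a geometrically
decaying contribution of the initial values. -/
theorem exists_movingAverage (K : ℕ) {c : ℝ} (hc : 0 < c) :
    ∃ A s : ℝ, 1 ≤ A ∧ 0 < s ∧ s < 1 ∧ ∀ ρ : Fin K → ℝ,
      (∀ z : ℂ, 1 - ∑ j : Fin K, (ρ j : ℂ) * z ^ ((j : ℕ) + 1) = 0 → 1 + c ≤ ‖z‖) →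
      (∀ j, |ρ j| ≤ A) ∧ ∃ h : ℕ → ℝ, (∀ k, |h k| ≤ A * s ^ k) ∧
        ∀ (T : ℕ) (e u : ℕ → ℝ), (∀ t ∈ Icc (K + 1) T, e t = lagVec K e t ⬝ᵥ ρ + u t) →
          ∀ M : ℝ, 0 ≤ M → (∀ t ∈ Icc 1 K, |e t| ≤ M) → ∀ t ∈ Icc 1 T,
            |e t - ∑ r ∈ Icc (K + 1) t, h (t - r) * u r| ≤ A * M * s ^ t := by
  obtain ⟨A, s, hA, hs0, hs1, H⟩ := exists_uniform_stability K hc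
  -- Series are indexed from `1` but stability is applied from index `0`; the division by `s` pays
  -- for this shift in the exponent.
  have hAs : A ≤ A / s := by
    rw [le_div_iff₀ hs0]
    nlinarith
  refine ⟨A / s, s, hA.trans hAs, hs0, hs1, fun ρ hρ => ?_⟩
  obtain ⟨hρA, hst⟩ := H ρ hρ
  refine ⟨fun j => (hρA j).trans hAs, fun k => impulse ρ (k + K), fun k => ?_, ?_⟩
  · have hg : ∀ n, |impulse ρ (n + 1)| ≤ A * 1 * s ^ n := by
      refine hst (fun n => impulse ρ (n + 1)) (fun n => ?_) 1 zero_le_one fun i hi => ?_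
      · rw [impulse_of_gt ρ (by omega)]
        refine sum_congr rfl fun j _ => ?_
        have hj := j.2
        congr 2
        omega
      · rcases (by omega : i + 1 < K ∨ i + 1 = K) with h | h
        · simp [impulse_of_lt ρ h]
        · simp [h, impulse_self]
    rcases Nat.eq_zero_or_pos (k + K) with h | h
    · obtain ⟨rfl, rfl⟩ : k = 0 ∧ K = 0 := by omega
      have := impulse_self ρ
      simp only [Nat.add_zero, pow_zero, mul_one] at *
      rw [this, abs_one]
      linarith
    · obtain ⟨m, hm⟩ : ∃ m, k + K = m + 1 := ⟨k + K - 1, by omega⟩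
      simp only [hm]
      refine (hg m).trans ?_
      have h3 : s ^ (m + 1) ≤ s ^ k := pow_le_pow_of_le_one hs0.le hs1.le (by omega)
      calc A * 1 * s ^ m = A / s * s ^ (m + 1) := by rw [pow_succ]; field_simp
        _ ≤ A / s * s ^ k := by gcongr
  · intro T e u he M hM hinit t ht
    -- Taking the input to be the defect of the recursion, rather than `u`, makes the recursion hold
    -- at all times, also beyond `T`; up to `T` the two agree.
    set w : ℕ → ℝ := fun n => e (n + K + 1) - ∑ j : Fin K, ρ j * e (n + (K - 1 - j) + 1) with hw
    have hwu : ∀ n, n + K + 1 ≤ T → w n = u (n + K + 1) := fun n hn => by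
      have h1 := he (n + K + 1) (mem_Icc.2 ⟨by omega, hn⟩)
      have h2 : lagVec K e (n + K + 1) ⬝ᵥ ρ = ∑ j : Fin K, ρ j * e (n + (K - 1 - j) + 1) := by
        refine sum_congr rfl fun j _ => ?_
        have hj := j.2
        rw [lagVec, mul_comm]
        congr 2
        omega
      simp only [hw]
      rw [h1, h2]
      ring
    -- The difference solves the homogeneous recursion and has the initial values of `e`.
    have hdiff := hst (fun m => e (m + 1) - response ρ w m) (fun n => by
      have h1 : e (n + K + 1) = ∑ j : Fin K, ρ j * e (n + (K - 1 - j) + 1) + w n := by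
        simp only [hw]
        ring
      simp only [mul_sub, sum_sub_distrib]
      rw [response_add ρ w n, h1]
      ring) M hM (fun i hi => by
        rw [response_of_lt ρ w hi, sub_zero]
        exact hinit (i + 1) (mem_Icc.2 ⟨by omega, by omega⟩)) (t - 1)
    rw [mem_Icc] at ht
    have hsum : ∑ r ∈ Icc (K + 1) t, impulse ρ (t - r + K) * u r = response ρ w (t - 1) := by
      rw [← Finset.Ico_succ_right_eq_Icc, sum_Ico_eq_sum_range, response]
      have : Order.succ t - (K + 1) = t - 1 + 1 - K := by
        simp only [Nat.succ_eq_succ]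
        omega
      rw [this]
      refine sum_congr rfl fun n hn => ?_
      simp only [mem_range] at hn
      rw [hwu n (by omega)]
      congr 2
      · omega
      · omega
    simp only [hsum]
    obtain ⟨m, rfl⟩ : ∃ m, t = m + 1 := ⟨t - 1, by omega⟩
    simp only [Nat.add_sub_cancel] at hdiff ⊢
    refine hdiff.trans (le_of_eq ?_)
    rw [pow_succ]
    field_simp

end Decomposition

/-! ### Calculus of `o_P` and `O_P`. -/

section StochasticOrder

variable {Ω : ℕ → Type*} [∀ T, MeasurableSpace (Ω T)] {P : ∀ T, Measure (Ω T)}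

/-- A sequence controlled by a bounded one and an asymptotically negligible one is asymptotically
negligible. -/
lemma isLittleOP_of_imp {X Y Z : ∀ T, Ω T → ℝ} (hY : IsBoundedInProb P Y)
    (hZ : IsLittleOP P Z fun _ => 1)
    (H : ∀ M : ℝ, 0 ≤ M → ∀ c : ℝ, 0 < c → ∃ d : ℝ, 0 < d ∧ ∀ᶠ T in atTop, ∀ ω,
      |Y T ω| ≤ M → |Z T ω| ≤ d → |X T ω| ≤ c) :
    IsLittleOP P X fun _ => 1 := by
  intro c hc
  rw [ENNReal.tendsto_nhds_zero]
  intro ε hε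
  obtain ⟨η, hη0, hη⟩ : ∃ η : ℝ, 0 < η ∧ ENNReal.ofReal η + ENNReal.ofReal η ≤ ε := by
    rcases eq_or_ne ε ⊤ with rfl | h
    · exact ⟨1, one_pos, le_top⟩
    · have h0 := ENNReal.toReal_pos hε.ne' h
      refine ⟨ε.toReal / 2, by positivity, ?_⟩
      rw [← ENNReal.ofReal_add (by positivity) (by positivity), add_halves,
        ENNReal.ofReal_toReal h]
  obtain ⟨M, hM⟩ := hY η hη0
  obtain ⟨d, hd, hH⟩ := H (max M 0) (le_max_right _ _) c hc
  have hZ' := (ENNReal.tendsto_nhds_zero.1 (hZ d hd)) (ENNReal.ofReal η)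
    (ENNReal.ofReal_pos.2 hη0)
  filter_upwards [hM, hH, hZ'] with T h1 h2 h3
  refine (measure_mono (t := {ω | M < |Y T ω|} ∪ {ω | d * 1 < |Z T ω|}) fun ω hω => ?_).trans
    ((measure_union_le _ _).trans ((add_le_add h1 h3).trans hη))
  by_contra hcon
  simp only [Set.mem_union, Set.mem_ofPred_eq, not_or, not_lt, mul_one] at hcon hω
  exact absurd (h2 ω (hcon.1.trans (le_max_left _ _)) hcon.2) (not_le.2 hω)

/-- A union bound. With `isLittleOP_of_imp`, it reduces most rules of the calculus to deterministic
inequalities on events of probability close to one. -/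
lemma isBoundedInProb_of_imp {X Y Z : ∀ T, Ω T → ℝ} (hY : IsBoundedInProb P Y)
    (hZ : IsBoundedInProb P Z)
    (H : ∀ M : ℝ, 0 ≤ M → ∃ B : ℝ, ∀ᶠ T in atTop, ∀ ω,
      |Y T ω| ≤ M → |Z T ω| ≤ M → |X T ω| ≤ B) :
    IsBoundedInProb P X := by
  intro η hη
  obtain ⟨M₁, h1⟩ := hY (η / 2) (by positivity)
  obtain ⟨M₂, h2⟩ := hZ (η / 2) (by positivity)
  obtain ⟨B, hB⟩ := H (max (max M₁ M₂) 0) (le_max_right _ _)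
  refine ⟨B, ?_⟩
  filter_upwards [h1, h2, hB] with T h1 h2 h3
  have h4 : ENNReal.ofReal (η / 2) + ENNReal.ofReal (η / 2) = ENNReal.ofReal η := by
    rw [← ENNReal.ofReal_add (by positivity) (by positivity), add_halves]
  refine (measure_mono (t := {ω | M₁ < |Y T ω|} ∪ {ω | M₂ < |Z T ω|}) fun ω hω => ?_).trans
    ((measure_union_le _ _).trans ((add_le_add h1 h2).trans h4.le))
  by_contra hcon
  simp only [Set.mem_union, Set.mem_ofPred_eq, not_or, not_lt] at hcon hω
  exact absurd (h3 ω (hcon.1.trans ((le_max_left _ _).trans (le_max_left _ _)))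
    (hcon.2.trans ((le_max_right _ _).trans (le_max_left _ _)))) (not_le.2 hω)

lemma isLittleOP_zero : IsLittleOP P (fun _ _ => 0) fun _ => 1 := by
  intro c hc
  have : ¬ c < 0 := not_lt.2 hc.le
  simp [this]

lemma isBoundedInProb_const (b : ℝ) : IsBoundedInProb P (fun _ _ => b) := by
  intro η _
  refine ⟨|b|, Eventually.of_forall fun T => ?_⟩
  simp

lemma IsLittleOP.isBoundedInProb {X : ∀ T, Ω T → ℝ} (h : IsLittleOP P X fun _ => 1) :
    IsBoundedInProb P X := by
  intro η hη
  refine ⟨1, ?_⟩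
  have := ENNReal.tendsto_nhds_zero.1 (h 1 one_pos) _ (ENNReal.ofReal_pos.2 hη)
  simpa using this

lemma IsLittleOP.mono {X Y : ∀ T, Ω T → ℝ} (hY : IsLittleOP P Y fun _ => 1)
    (h : ∀ᶠ T in atTop, ∀ ω, |X T ω| ≤ |Y T ω|) : IsLittleOP P X fun _ => 1 :=
  isLittleOP_of_imp (isBoundedInProb_const 0) hY fun _ _ c hc =>
    ⟨c, hc, h.mono fun _ hT ω _ h2 => (hT ω).trans h2⟩

lemma IsBoundedInProb.mono {X Y : ∀ T, Ω T → ℝ} (hY : IsBoundedInProb P Y)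
    (h : ∀ᶠ T in atTop, ∀ ω, |X T ω| ≤ |Y T ω|) : IsBoundedInProb P X :=
  isBoundedInProb_of_imp hY hY fun M _ => ⟨M, h.mono fun _ hT ω h2 _ => (hT ω).trans h2⟩

lemma IsBoundedInProb.add {X Y : ∀ T, Ω T → ℝ} (hX : IsBoundedInProb P X)
    (hY : IsBoundedInProb P Y) : IsBoundedInProb P fun T ω => X T ω + Y T ω :=
  isBoundedInProb_of_imp hX hY fun M _ => ⟨M + M, Eventually.of_forall fun _ _ h1 h2 =>
    (abs_add_le _ _).trans (add_le_add h1 h2)⟩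

lemma IsBoundedInProb.mul {X Y : ∀ T, Ω T → ℝ} (hX : IsBoundedInProb P X)
    (hY : IsBoundedInProb P Y) : IsBoundedInProb P fun T ω => X T ω * Y T ω :=
  isBoundedInProb_of_imp hX hY fun M hM => ⟨M * M, Eventually.of_forall fun _ _ h1 h2 => by
    rw [abs_mul]; gcongr⟩

lemma IsBoundedInProb.mul_isLittleOP {X Y : ∀ T, Ω T → ℝ} (hX : IsBoundedInProb P X)
    (hY : IsLittleOP P Y fun _ => 1) : IsLittleOP P (fun T ω => X T ω * Y T ω) fun _ => 1 :=
  isLittleOP_of_imp hX hY fun M hM c hc => ⟨c / (M + 1), by positivity,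
    Eventually.of_forall fun T ω h1 h2 => by
      rw [abs_mul]
      calc |X T ω| * |Y T ω| ≤ M * (c / (M + 1)) := by gcongr
        _ ≤ (M + 1) * (c / (M + 1)) := by gcongr; linarith
        _ = c := by field_simp⟩

lemma IsLittleOP.abs {X : ∀ T, Ω T → ℝ} (hX : IsLittleOP P X fun _ => 1) :
    IsLittleOP P (fun T ω => |X T ω|) fun _ => 1 :=
  hX.mono (Eventually.of_forall fun _ _ => by simp)

lemma IsLittleOP.add {X Y : ∀ T, Ω T → ℝ} (hX : IsLittleOP P X fun _ => 1)
    (hY : IsLittleOP P Y fun _ => 1) : IsLittleOP P (fun T ω => X T ω + Y T ω) fun _ => 1 := by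
  intro c hc
  have h := (hX (c / 2) (by positivity)).add (hY (c / 2) (by positivity))
  rw [add_zero] at h
  refine tendsto_of_tendsto_of_tendsto_of_le_of_le tendsto_const_nhds h (fun _ => zero_le)
    fun T => ?_
  refine (measure_mono fun ω hω => ?_).trans (measure_union_le _ _)
  by_contra hcon
  simp only [Set.mem_union, Set.mem_ofPred_eq, not_or, not_lt, mul_one] at hcon hω
  linarith [abs_add_le (X T ω) (Y T ω), hcon.1, hcon.2]

lemma isLittleOP_sum {ι : Type*} (s : Finset ι) {X : ι → ∀ T, Ω T → ℝ}
    (h : ∀ i ∈ s, IsLittleOP P (X i) fun _ => 1) :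
    IsLittleOP P (fun T ω => ∑ i ∈ s, X i T ω) fun _ => 1 := by
  classical
  induction s using Finset.induction_on with
  | empty => simpa using isLittleOP_zero
  | insert i s hi ih =>
    simp only [sum_insert hi]
    exact (h i (mem_insert_self _ _)).add (ih fun j hj => h j (mem_insert_of_mem hj))

lemma isBoundedInProb_sum {ι : Type*} (s : Finset ι) {X : ι → ∀ T, Ω T → ℝ}
    (h : ∀ i ∈ s, IsBoundedInProb P (X i)) :
    IsBoundedInProb P (fun T ω => ∑ i ∈ s, X i T ω) := by
  classical
  induction s using Finset.induction_on with
  | empty => simpa using isBoundedInProb_const 0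
  | insert i s hi ih =>
    simp only [sum_insert hi]
    exact (h i (mem_insert_self _ _)).add (ih fun j hj => h j (mem_insert_of_mem hj))

lemma IsLittleOP.sqrt {X : ∀ T, Ω T → ℝ} (hX : IsLittleOP P X fun _ => 1) :
    IsLittleOP P (fun T ω => √(X T ω)) fun _ => 1 :=
  isLittleOP_of_imp (isBoundedInProb_const 0) hX fun _ _ c hc => ⟨c ^ 2, by positivity,
    Eventually.of_forall fun T ω _ h => by
      rw [abs_of_nonneg (Real.sqrt_nonneg _), Real.sqrt_le_left hc.le]
      exact (le_abs_self _).trans h⟩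

lemma isLittleOP_natCast_iff {X : ∀ T, Ω T → ℝ} :
    IsLittleOP P X (fun T => (T : ℝ)) ↔ IsLittleOP P (fun T ω => X T ω / T) fun _ => 1 := by
  refine forall₂_congr fun c hc => tendsto_congr' ?_
  filter_upwards [eventually_gt_atTop 0] with T hT
  have hT' : (0 : ℝ) < T := by exact_mod_cast hT
  congr 1
  ext ω
  simp only [Set.mem_ofPred_eq, mul_one]
  rw [abs_div, abs_of_pos hT', lt_div_iff₀ hT']

/-- Markov's inequality. -/
lemma measure_lt_le_of_integral_le {Ω : Type*} [MeasurableSpace Ω] {μ : Measure Ω}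
    [IsFiniteMeasure μ] {f : Ω → ℝ} (hf : Integrable f μ) (h0 : ∀ ω, 0 ≤ f ω) {a b : ℝ}
    (ha : 0 < a) (hb : ∫ ω, f ω ∂μ ≤ b) : μ {ω | a < f ω} ≤ ENNReal.ofReal (b / a) := by
  have h1 := mul_meas_ge_le_integral_of_nonneg (Eventually.of_forall h0) hf a
  refine (measure_mono (t := {ω | a ≤ f ω}) fun ω hω => (show a < f ω from hω).le).trans ?_
  rw [← ENNReal.ofReal_toReal (measure_ne_top μ {ω | a ≤ f ω})]
  refine ENNReal.ofReal_le_ofReal ?_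
  rw [le_div_iff₀ ha, mul_comm]
  exact h1.trans hb

lemma IsLittleOP.of_sq {X : ∀ T, Ω T → ℝ} (h : IsLittleOP P (fun T ω => X T ω ^ 2) fun _ => 1) :
    IsLittleOP P X fun _ => 1 :=
  h.sqrt.mono (Eventually.of_forall fun T ω => by simp [Real.sqrt_sq_eq_abs])

lemma IsBoundedInProb.of_sq {X : ∀ T, Ω T → ℝ} (h : IsBoundedInProb P fun T ω => X T ω ^ 2) :
    IsBoundedInProb P X :=
  isBoundedInProb_of_imp h h fun M hM => ⟨√M, Eventually.of_forall fun T ω h1 _ => by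
    rw [abs_of_nonneg (sq_nonneg _)] at h1
    exact Real.abs_le_sqrt h1⟩

variable [∀ T, IsProbabilityMeasure (P T)]

lemma isBoundedInProb_of_integral_le {X : ∀ T, Ω T → ℝ} {b : ℝ}
    (h : ∀ᶠ T in atTop, Integrable (X T) (P T) ∧ (∀ ω, 0 ≤ X T ω) ∧ ∫ ω, X T ω ∂(P T) ≤ b) :
    IsBoundedInProb P X := by
  intro η hη
  refine ⟨(|b| + 1) / η, ?_⟩
  filter_upwards [h] with T ⟨h1, h2, h3⟩
  simp only [abs_of_nonneg (h2 _)]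
  refine (measure_lt_le_of_integral_le h1 h2 (by positivity) h3).trans
    (ENNReal.ofReal_le_ofReal ?_)
  rw [div_div_eq_mul_div, div_le_iff₀ (by positivity), mul_comm]
  gcongr
  linarith [le_abs_self b]

lemma isLittleOP_of_integral_le {X : ∀ T, Ω T → ℝ} {b : ℕ → ℝ} (hb : Tendsto b atTop (𝓝 0))
    (h : ∀ᶠ T in atTop, Integrable (X T) (P T) ∧ (∀ ω, 0 ≤ X T ω) ∧ ∫ ω, X T ω ∂(P T) ≤ b T) :
    IsLittleOP P X fun _ => 1 := by
  intro c hc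
  have h1 : Tendsto (fun T => ENNReal.ofReal (b T / c)) atTop (𝓝 0) := by
    have := ENNReal.tendsto_ofReal (hb.div_const c)
    simpa using this
  refine tendsto_of_tendsto_of_tendsto_of_le_of_le' tendsto_const_nhds h1
    (Eventually.of_forall fun _ => zero_le) ?_
  filter_upwards [h] with T ⟨h1, h2, h3⟩
  simp only [abs_of_nonneg (h2 _), mul_one]
  exact measure_lt_le_of_integral_le h1 h2 hc h3

end StochasticOrder

/-! ### Second moments of sums of products of innovations. -/

section Moments

/-- Cauchy-Schwarz with weights `|h i|`: for geometric weights the cost does not grow with the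
number of terms. -/
lemma sq_sum_mul_le {ι : Type*} (s : Finset ι) (h q : ι → ℝ) :
    (∑ i ∈ s, h i * q i) ^ 2 ≤ (∑ i ∈ s, |h i|) * ∑ i ∈ s, |h i| * q i ^ 2 :=
  sum_sq_le_sum_mul_sum_of_sq_le_mul s (fun _ _ => abs_nonneg _)
    (fun _ _ => mul_nonneg (abs_nonneg _) (sq_nonneg _)) fun i _ => le_of_eq (by
      rw [← mul_assoc, abs_mul_abs_self]
      ring)

lemma sum_range_abs_le {A s : ℝ} (hA : 0 ≤ A) (hs0 : 0 ≤ s) (hs1 : s < 1) {h : ℕ → ℝ}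
    (hh : ∀ k, |h k| ≤ A * s ^ k) (n : ℕ) : ∑ k ∈ range n, |h k| ≤ A / (1 - s) := by
  have h1 : ∑ k ∈ range n, s ^ k ≤ (1 - s)⁻¹ := by
    rw [← tsum_geometric_of_lt_one hs0 hs1]
    exact (summable_geometric_of_lt_one hs0 hs1).sum_le_tsum _ fun _ _ => by positivity
  calc ∑ k ∈ range n, |h k| ≤ ∑ k ∈ range n, A * s ^ k := sum_le_sum fun k _ => hh k
    _ = A * ∑ k ∈ range n, s ^ k := by rw [mul_sum]
    _ ≤ A * (1 - s)⁻¹ := by gcongr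
    _ = _ := (div_eq_mul_inv _ _).symm

variable {Ω : Type*} [MeasurableSpace Ω] {μ : Measure Ω}

/-- Cross terms vanish, so the bound is linear in the number of summands. After division by `T ^ 2`
it tends to zero, which serves as the law of large numbers here. -/
lemma integral_sq_sum_le_of_orthogonal {ι : Type*} (s : Finset ι) {X : ι → Ω → ℝ} {M : ℝ}
    (hX : ∀ i ∈ s, MemLp (X i) 2 μ)
    (horth : ∀ i ∈ s, ∀ j ∈ s, i ≠ j → ∫ ω, X i ω * X j ω ∂μ = 0)
    (hM : ∀ i ∈ s, ∫ ω, X i ω ^ 2 ∂μ ≤ M) :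
    ∫ ω, (∑ i ∈ s, X i ω) ^ 2 ∂μ ≤ #s * M := by
  classical
  have hint : ∀ i ∈ s, ∀ j ∈ s, Integrable (fun ω => X i ω * X j ω) μ := fun i hi j hj =>
    (hX i hi).integrable_mul (hX j hj)
  simp_rw [sq, sum_mul_sum]
  rw [integral_finsetSum _ fun i hi => integrable_finsetSum _ fun j hj => hint i hi j hj,
    ← nsmul_eq_mul]
  refine sum_le_card_nsmul _ _ _ fun i hi => ?_
  rw [integral_finsetSum _ fun j hj => hint i hi j hj, sum_eq_single i
    (fun j hj hij => horth i hi j hj hij.symm) (fun h => absurd hi h)]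
  simpa [sq] using hM i hi

lemma memLp_sum_mul {ι : Type*} (s : Finset ι) {p : ℝ≥0∞} {X : ι → Ω → ℝ} (h : ι → ℝ)
    (hX : ∀ i ∈ s, MemLp (X i) p μ) : MemLp (fun ω => ∑ i ∈ s, h i * X i ω) p μ :=
  memLp_finsetSum s fun i hi => (hX i hi).const_mul (h i)

lemma integral_sq_sum_mul_le {ι : Type*} (s : Finset ι) {X : ι → Ω → ℝ} (h : ι → ℝ) {B M : ℝ}
    (hB : ∑ i ∈ s, |h i| ≤ B) (hM0 : 0 ≤ M) (hX : ∀ i ∈ s, MemLp (X i) 2 μ)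
    (hM : ∀ i ∈ s, ∫ ω, X i ω ^ 2 ∂μ ≤ M) :
    ∫ ω, (∑ i ∈ s, h i * X i ω) ^ 2 ∂μ ≤ B ^ 2 * M := by
  have hint : ∀ i ∈ s, Integrable (fun ω => |h i| * X i ω ^ 2) μ := fun i hi =>
    (hX i hi).integrable_sq.const_mul _
  have h0 : 0 ≤ ∑ i ∈ s, |h i| := sum_nonneg fun i _ => abs_nonneg _
  calc ∫ ω, (∑ i ∈ s, h i * X i ω) ^ 2 ∂μ
      ≤ ∫ ω, (∑ i ∈ s, |h i|) * ∑ i ∈ s, |h i| * X i ω ^ 2 ∂μ :=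
        integral_mono (memLp_sum_mul s h hX).integrable_sq
          ((integrable_finsetSum _ hint).const_mul _) fun ω => sq_sum_mul_le _ _ _
    _ = (∑ i ∈ s, |h i|) * ∑ i ∈ s, |h i| * ∫ ω, X i ω ^ 2 ∂μ := by
        rw [integral_const_mul, integral_finsetSum _ hint]
        simp_rw [integral_const_mul]
    _ ≤ (∑ i ∈ s, |h i|) * ((∑ i ∈ s, |h i|) * M) := by
        refine mul_le_mul_of_nonneg_left ?_ h0
        rw [sum_mul]
        exact sum_le_sum fun i hi => mul_le_mul_of_nonneg_left (hM i hi) (abs_nonneg _)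
    _ ≤ B * (B * M) := by gcongr; exact h0.trans hB
    _ = B ^ 2 * M := by ring

/-- Centered innovations `u_1, …, u_T`, independent, with fourth moments at most `M`. -/
structure IsNoise (μ : Measure Ω) (T : ℕ) (u : ℕ → Ω → ℝ) (M : ℝ) : Prop where
  indep : iIndepFun (fun t : Set.Icc 1 T => u t) μ
  memLp : ∀ t ∈ Icc 1 T, MemLp (u t) 4 μ
  mean : ∀ t ∈ Icc 1 T, ∫ ω, u t ω ∂μ = 0
  fourth : ∀ t ∈ Icc 1 T, ∫ ω, u t ω ^ 4 ∂μ ≤ M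

instance : ENNReal.HolderTriple 4 4 2 where
  inv_add_inv_eq_inv := by
    rw [← two_mul, (by norm_num : (4 : ℝ≥0∞) = 2 * 2), ENNReal.mul_inv (by simp) (by simp),
      ← mul_assoc, ENNReal.mul_inv_cancel (by simp) (by simp), one_mul]

variable {T : ℕ} {u : ℕ → Ω → ℝ} {M : ℝ}

namespace IsNoise

lemma memLp_mul (hu : IsNoise μ T u M) {a b : ℕ} (ha : a ∈ Icc 1 T) (hb : b ∈ Icc 1 T) :
    MemLp (fun ω => u a ω * u b ω) 2 μ :=
  (hu.memLp b hb).mul' (hu.memLp a ha)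

lemma integrable_fourth (hu : IsNoise μ T u M) {a : ℕ} (ha : a ∈ Icc 1 T) :
    Integrable (fun ω => u a ω ^ 4) μ := by
  have := (hu.memLp_mul ha ha).integrable_sq
  refine this.congr (Eventually.of_forall fun ω => ?_)
  simp only
  ring

lemma integral_sq_mul_le (hu : IsNoise μ T u M) {a b : ℕ} (ha : a ∈ Icc 1 T) (hb : b ∈ Icc 1 T) :
    ∫ ω, (u a ω * u b ω) ^ 2 ∂μ ≤ M := by
  calc ∫ ω, (u a ω * u b ω) ^ 2 ∂μ ≤ ∫ ω, (2⁻¹ * u a ω ^ 4 + 2⁻¹ * u b ω ^ 4) ∂μ :=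
        integral_mono (hu.memLp_mul ha hb).integrable_sq
          (((hu.integrable_fourth ha).const_mul _).add ((hu.integrable_fourth hb).const_mul _))
          fun ω => by
            simp only
            nlinarith [sq_nonneg (u a ω ^ 2 - u b ω ^ 2)]
    _ = 2⁻¹ * ∫ ω, u a ω ^ 4 ∂μ + 2⁻¹ * ∫ ω, u b ω ^ 4 ∂μ := by
        rw [integral_add ((hu.integrable_fourth ha).const_mul _)
          ((hu.integrable_fourth hb).const_mul _), integral_const_mul, integral_const_mul]
    _ ≤ 2⁻¹ * M + 2⁻¹ * M := by
        gcongr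
        · exact hu.fourth a ha
        · exact hu.fourth b hb
    _ = M := by ring

/-- The index `d` occurs only once, so the centered factor `u d` is independent of the rest; `a`,
`b`, `c` may coincide. -/
lemma integral_mul_eq_zero (hu : IsNoise μ T u M) {a b c d : ℕ} (ha : a ∈ Icc 1 T)
    (hb : b ∈ Icc 1 T) (hc : c ∈ Icc 1 T) (hd : d ∈ Icc 1 T) (hda : a ≠ d) (hdb : b ≠ d)
    (hdc : c ≠ d) : ∫ ω, (u a ω * u b ω * u c ω) * u d ω ∂μ = 0 := by
  classical
  have hcoe : ∀ {t}, t ∈ Icc 1 T → t ∈ Set.Icc 1 T := fun h => by simpa using h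
  let a' : Set.Icc 1 T := ⟨a, hcoe ha⟩
  let b' : Set.Icc 1 T := ⟨b, hcoe hb⟩
  let c' : Set.Icc 1 T := ⟨c, hcoe hc⟩
  let d' : Set.Icc 1 T := ⟨d, hcoe hd⟩
  have hmeas : ∀ t ∈ Icc 1 T, AEMeasurable (u t) μ := fun t ht => (hu.memLp t ht).1.aemeasurable
  have h1 := hu.indep.indepFun_finset₀ {a', b', c'} {d'}
    (by simp [a', b', c', d', hda.symm, hdb.symm, hdc.symm])
    fun t => hmeas t (Finset.mem_Icc.2 t.2)
  have h2 := h1.comp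
    (φ := fun x : ({a', b', c'} : Finset (Set.Icc 1 T)) → ℝ =>
      x ⟨a', by simp⟩ * x ⟨b', by simp⟩ * x ⟨c', by simp⟩)
    (ψ := fun x : ({d'} : Finset (Set.Icc 1 T)) → ℝ => x ⟨d', by simp⟩)
    (by fun_prop)
    (measurable_pi_apply (X := fun _ => ℝ) (⟨d', by simp⟩ : ({d'} : Finset (Set.Icc 1 T))))
  have h3 := h2.integral_fun_mul_eq_mul_integral
    ((((hmeas a ha).mul (hmeas b hb)).mul (hmeas c hc)).aestronglyMeasurable)
    (hmeas d hd).aestronglyMeasurable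
  have h4 : ∫ ω, ((fun x : ({d'} : Finset (Set.Icc 1 T)) → ℝ => x ⟨d', by simp⟩) ∘
      fun ω i => u i ω) ω ∂μ = 0 := hu.mean d hd
  rw [h4, mul_zero] at h3
  exact h3

/-- The sum of products `u_{p t} u_{q t}`, where `p t` is later than all other indices that occur
up to `t`, has second moment of the order of the number of summands. -/
lemma integral_sq_sum_mul_le (hu : IsNoise μ T u M) (s : Finset ℕ) {p q : ℕ → ℕ}
    (hp : ∀ t ∈ s, p t ∈ Icc 1 T) (hq : ∀ t ∈ s, q t ∈ Icc 1 T) (hqp : ∀ t ∈ s, q t < p t)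
    (hmono : ∀ t ∈ s, ∀ t' ∈ s, t < t' → p t < p t' ∧ q t' ≠ p t') :
    ∫ ω, (∑ t ∈ s, u (p t) ω * u (q t) ω) ^ 2 ∂μ ≤ #s * M := by
  -- For `t < t'`, the innovation at `p t'` is the latest of the four and occurs once.
  have key : ∀ t ∈ s, ∀ t' ∈ s, t < t' →
      ∫ ω, (u (p t) ω * u (q t) ω) * (u (p t') ω * u (q t') ω) ∂μ = 0 := by
    intro t ht t' ht' h
    obtain ⟨h1, h2⟩ := hmono t ht t' ht' h
    have h3 := hqp t ht
    rw [← hu.integral_mul_eq_zero (hp t ht) (hq t ht) (hq t' ht') (hp t' ht') h1.ne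
      (h3.trans h1).ne h2]
    exact integral_congr_ae (Eventually.of_forall fun ω => by simp only; ring)
  refine integral_sq_sum_le_of_orthogonal s (fun t ht => hu.memLp_mul (hp t ht) (hq t ht))
    (fun t ht t' ht' h => ?_) fun t ht => hu.integral_sq_mul_le (hp t ht) (hq t ht)
  rcases lt_or_gt_of_ne h with h | h
  · exact key t ht t' ht' h
  · rw [← key t' ht' t ht h]
    exact integral_congr_ae (Eventually.of_forall fun ω => mul_comm _ _)

lemma nonneg (hu : IsNoise μ T u M) (hT : 1 ≤ T) : 0 ≤ M :=
  (integral_nonneg fun _ => by positivity).trans (hu.fourth 1 (mem_Icc.2 ⟨le_rfl, hT⟩))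

variable [IsProbabilityMeasure μ]

lemma memLp_two (hu : IsNoise μ T u M) {a : ℕ} (ha : a ∈ Icc 1 T) : MemLp (u a) 2 μ :=
  (hu.memLp a ha).mono_exponent (by norm_num)

lemma integral_sq_le (hu : IsNoise μ T u M) {a : ℕ} (ha : a ∈ Icc 1 T) :
    ∫ ω, u a ω ^ 2 ∂μ ≤ 1 + M := by
  calc ∫ ω, u a ω ^ 2 ∂μ ≤ ∫ ω, (1 + u a ω ^ 4) ∂μ :=
        integral_mono (hu.memLp_two ha).integrable_sq
          ((integrable_const _).add (hu.integrable_fourth ha)) fun ω => by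
            simp only
            nlinarith [sq_nonneg (u a ω ^ 2 - 1), sq_nonneg (u a ω ^ 2)]
    _ = 1 + ∫ ω, u a ω ^ 4 ∂μ := by
        rw [integral_add (integrable_const _) (hu.integrable_fourth ha)]
        simp
    _ ≤ 1 + M := by
        gcongr
        exact hu.fourth a ha

/-- The sum of centered squares has second moment of the order of the number of summands. -/
lemma integral_sq_sum_sq_le (hu : IsNoise μ T u M) (s : Finset ℕ) {p : ℕ → ℕ}
    (hp : ∀ t ∈ s, p t ∈ Icc 1 T) (hinj : ∀ t ∈ s, ∀ t' ∈ s, t ≠ t' → p t ≠ p t') :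
    ∫ ω, (∑ t ∈ s, (u (p t) ω * u (p t) ω - ∫ ω', u (p t) ω' ^ 2 ∂μ)) ^ 2 ∂μ ≤ #s * M := by
  have hmem : ∀ t ∈ s, MemLp (fun ω => u (p t) ω * u (p t) ω - ∫ ω', u (p t) ω' ^ 2 ∂μ) 2 μ :=
    fun t ht => (hu.memLp_mul (hp t ht) (hp t ht)).sub (memLp_const _)
  have hzero : ∀ t ∈ s, ∫ ω, (u (p t) ω * u (p t) ω - ∫ ω', u (p t) ω' ^ 2 ∂μ) ∂μ = 0 := by
    intro t ht
    rw [integral_sub ((hu.memLp_mul (hp t ht) (hp t ht)).integrable (by norm_num))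
      (integrable_const _)]
    simp [sq]
  refine integral_sq_sum_le_of_orthogonal s hmem (fun t ht t' ht' h => ?_) fun t ht => ?_
  · have hcoe : ∀ {t}, t ∈ Icc 1 T → t ∈ Set.Icc 1 T := fun h => by simpa using h
    have h1 : IndepFun (u (p t)) (u (p t')) μ :=
      hu.indep.indepFun (i := ⟨p t, hcoe (hp t ht)⟩) (j := ⟨p t', hcoe (hp t' ht')⟩)
        (by simpa using hinj t ht t' ht' h)
    have h2 := h1.comp (φ := fun x => x * x - ∫ ω', u (p t) ω' ^ 2 ∂μ)
      (ψ := fun x => x * x - ∫ ω', u (p t') ω' ^ 2 ∂μ) (by fun_prop) (by fun_prop)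
    have h3 := h2.integral_fun_mul_eq_mul_integral (hmem t ht).1 (hmem t' ht').1
    have h4 : ∫ ω, ((fun x => x * x - ∫ ω', u (p t) ω' ^ 2 ∂μ) ∘ u (p t)) ω ∂μ = 0 := hzero t ht
    rw [h4, zero_mul] at h3
    exact h3
  · set m := ∫ ω', u (p t) ω' ^ 2 ∂μ with hm
    -- The variance of the square is the fourth moment minus `m ^ 2`, hence at most `M`.
    have h1 : ∀ ω, (u (p t) ω * u (p t) ω - m) ^ 2 =
        (u (p t) ω * u (p t) ω) ^ 2 - (2 * m * u (p t) ω ^ 2 - m ^ 2) := fun ω => by ring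
    have h2 : Integrable (fun ω => 2 * m * u (p t) ω ^ 2) μ :=
      (hu.memLp_two (hp t ht)).integrable_sq.const_mul _
    simp_rw [h1]
    have h4 : Integrable (fun ω => 2 * m * u (p t) ω ^ 2 - m ^ 2) μ := h2.sub (integrable_const _)
    rw [integral_sub (hu.memLp_mul (hp t ht) (hp t ht)).integrable_sq h4, integral_sub h2 (integrable_const _), integral_const_mul,
      ← hm]
    have h3 := hu.integral_sq_mul_le (hp t ht) (hp t ht)
    simp only [integral_const, probReal_univ, one_smul]
    nlinarith [sq_nonneg m]

end IsNoise

/-- The moving average `∑_{r = K+1}^t h_{t-r} u_r`. -/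
noncomputable def movingAverage (K : ℕ) (h : ℕ → ℝ) (u : ℕ → ℝ) (t : ℕ) : ℝ :=
  ∑ r ∈ Icc (K + 1) t, h (t - r) * u r

lemma movingAverage_eq_sum_range (K : ℕ) (h u : ℕ → ℝ) (t : ℕ) :
    movingAverage K h u t = ∑ k ∈ range (t - K), h k * u (t - k) := by
  refine sum_bij' (fun r _ => t - r) (fun k _ => t - k) ?_ ?_ ?_ ?_ ?_
  · intro r hr
    simp only [mem_Icc, mem_range] at *
    omega
  · intro k hk
    simp only [mem_Icc, mem_range] at *
    omega
  · intro r hr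
    simp only [mem_Icc] at *
    omega
  · intro k hk
    simp only [mem_range] at *
    omega
  · intro r hr
    simp only [mem_Icc] at *
    rw [(by omega : t - (t - r) = r)]

namespace IsNoise

variable {K : ℕ} {h : ℕ → ℝ} {A s : ℝ}

/-- Summing over the weights last leaves, for each `k`, a sum of products at the fixed lag `i + k`.
For `i ≥ 1` its terms are orthogonal. -/
lemma sum_movingAverage_mul (u : ℕ → ℝ) (i : ℕ) :
    ∑ t ∈ Icc (K + 1) T, movingAverage K h u (t - i) * u t =
      ∑ k ∈ range T, h k * ∑ t ∈ Icc (K + 1 + i + k) T, u t * u (t - i - k) := by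
  simp_rw [movingAverage_eq_sum_range, sum_mul, mul_sum]
  rw [sum_comm' (t' := range T) (s' := fun k => Icc (K + 1 + i + k) T)]
  · exact sum_congr rfl fun k _ => sum_congr rfl fun t _ => by ring
  · intro t k
    simp only [mem_range, mem_Icc]
    omega

lemma integrable_sq_sum_movingAverage_mul (hu : IsNoise μ T u M) {i : ℕ} (hi : 1 ≤ i) :
    Integrable (fun ω =>
      (∑ t ∈ Icc (K + 1) T, movingAverage K h (fun r => u r ω) (t - i) * u t ω) ^ 2) μ := by
  simp_rw [fun ω => sum_movingAverage_mul (K := K) (T := T) (h := h) (fun r => u r ω) i]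
  refine (memLp_sum_mul _ _ fun k _ => memLp_finsetSum _ fun t ht =>
    hu.memLp_mul ?_ ?_).integrable_sq
  all_goals
    simp only [mem_Icc] at *
    omega

/-- Each inner sum has second moment at most `T * M` by orthogonality; the weighted Cauchy-Schwarz
inequality then costs only the squared total weight. -/
lemma integral_sq_sum_movingAverage_mul_le (hu : IsNoise μ T u M) (hM : 0 ≤ M) (hA : 0 ≤ A)
    (hs0 : 0 ≤ s) (hs1 : s < 1) (hh : ∀ k, |h k| ≤ A * s ^ k) {i : ℕ} (hi : 1 ≤ i) :
    ∫ ω, (∑ t ∈ Icc (K + 1) T, movingAverage K h (fun r => u r ω) (t - i) * u t ω) ^ 2 ∂μ ≤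
      (A / (1 - s)) ^ 2 * (T * M) := by
  simp_rw [fun ω => sum_movingAverage_mul (K := K) (T := T) (h := h) (fun r => u r ω) i]
  refine FusedAR.integral_sq_sum_mul_le _ _ (sum_range_abs_le hA hs0 hs1 hh _) (by positivity)
    (fun k _ => memLp_finsetSum _ fun t ht => hu.memLp_mul ?_ ?_) fun k _ => ?_
  · simp only [mem_Icc] at *
    omega
  · simp only [mem_Icc] at *
    omega
  · refine (hu.integral_sq_sum_mul_le (Icc (K + 1 + i + k) T) (p := fun t => t)
      (q := fun t => t - i - k) ?_ ?_ ?_ ?_).trans ?_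
    · intro t ht
      simp only [mem_Icc] at *
      omega
    · intro t ht
      simp only [mem_Icc] at *
      omega
    · intro t ht
      simp only [mem_Icc] at *
      omega
    · intro t ht t' ht' h
      simp only [mem_Icc] at *
      omega
    · gcongr
      rw [Nat.card_Icc]
      omega

variable [IsProbabilityMeasure μ]

lemma memLp_movingAverage (hu : IsNoise μ T u M) {t : ℕ} (ht : t ≤ T) :
    MemLp (fun ω => movingAverage K h (fun r => u r ω) t) 2 μ :=
  memLp_sum_mul _ _ fun r hr => hu.memLp_two (by simp only [mem_Icc] at *; omega)

lemma integral_sq_movingAverage_le (hu : IsNoise μ T u M) (hM : 0 ≤ M) (hA : 0 ≤ A) (hs0 : 0 ≤ s)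
    (hs1 : s < 1) (hh : ∀ k, |h k| ≤ A * s ^ k) {t : ℕ} (ht : t ≤ T) :
    ∫ ω, movingAverage K h (fun r => u r ω) t ^ 2 ∂μ ≤ (A / (1 - s)) ^ 2 * (1 + M) := by
  simp_rw [movingAverage_eq_sum_range]
  refine FusedAR.integral_sq_sum_mul_le _ _ (sum_range_abs_le hA hs0 hs1 hh _) (by positivity)
    (fun k hk => hu.memLp_two ?_) fun k hk => hu.integral_sq_le ?_
  all_goals
    simp only [mem_range, mem_Icc] at *
    omega

end IsNoise

end Moments

/-! ### Deterministic least squares bounds. -/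

section LeastSquares

variable {K : ℕ} {ρ : Fin K → ℝ} {A : ℝ} {T : ℕ}

/-- The residual `x_t - ∑ ρ_j x_{t-j}` of an autoregression. -/
noncomputable def residual (ρ : Fin K → ℝ) (x : ℕ → ℝ) (t : ℕ) : ℝ := x t - lagVec K x t ⬝ᵥ ρ

lemma residual_sub (ρ : Fin K → ℝ) (x y : ℕ → ℝ) (t : ℕ) :
    residual ρ (fun s => x s - y s) t = residual ρ x t - residual ρ y t := by
  simp only [residual, lagVec, dotProduct, sub_mul, sum_sub_distrib]
  ring

/-- Lag filters commute. This turns the filtered regressor `x_t'v` into a combination of residuals,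
that is, of nearly orthogonal noise. -/
lemma residual_lagVec_dotProduct (ρ v : Fin K → ℝ) (x : ℕ → ℝ) (t : ℕ) :
    residual ρ (fun s => lagVec K x s ⬝ᵥ v) t = ∑ i : Fin K, v i * residual ρ x (t - (i + 1)) := by
  simp only [residual, lagVec, dotProduct, mul_sub, sum_sub_distrib, mul_sum, sum_mul]
  congr 1
  · exact sum_congr rfl fun i _ => mul_comm _ _
  · rw [sum_comm]
    refine sum_congr rfl fun i _ => sum_congr rfl fun j _ => ?_
    rw [Nat.sub_right_comm]
    ring

/-- The condition `b + k ≤ a` keeps the truncated subtraction injective and the shifted window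
inside `Icc b T`. -/
lemma sum_lag_le {f : ℕ → ℝ} (hf : ∀ t, 0 ≤ f t) {a b k : ℕ} (h : b + k ≤ a) :
    ∑ t ∈ Icc a T, f (t - k) ≤ ∑ t ∈ Icc b T, f t := by
  rw [← sum_image (f := f) (g := fun t => t - k)]
  · refine sum_le_sum_of_subset_of_nonneg ?_ fun t _ _ => hf t
    intro t ht
    simp only [mem_image, mem_Icc] at *
    obtain ⟨r, hr, rfl⟩ := ht
    omega
  · intro r hr t ht hrt
    simp only [coe_Icc, Set.mem_Icc] at *
    omega

lemma sq_dotProduct_le (hρ : ∀ j, |ρ j| ≤ A) (x : Fin K → ℝ) :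
    (x ⬝ᵥ ρ) ^ 2 ≤ K * A ^ 2 * ∑ j, x j ^ 2 := by
  have h1 : (x ⬝ᵥ ρ) ^ 2 ≤ (∑ j, x j ^ 2) * ∑ j, ρ j ^ 2 := sum_mul_sq_le_sq_mul_sq _ _ _
  have h2 : ∑ j, ρ j ^ 2 ≤ ∑ _j : Fin K, A ^ 2 := sum_le_sum fun j _ => by
    rw [← sq_abs]
    have := hρ j
    gcongr
  have h3 : 0 ≤ ∑ j, x j ^ 2 := sum_nonneg fun _ _ => sq_nonneg _
  rw [sum_const, card_univ, Fintype.card_fin, nsmul_eq_mul] at h2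
  calc _ ≤ _ := h1
    _ ≤ (∑ j, x j ^ 2) * (K * A ^ 2) := by gcongr
    _ = _ := mul_comm _ _

lemma sum_sum_sq_lagVec_le (x : ℕ → ℝ) {a b : ℕ} (h : b + K ≤ a) :
    ∑ t ∈ Icc a T, ∑ j : Fin K, lagVec K x t j ^ 2 ≤ K * ∑ t ∈ Icc b T, x t ^ 2 := by
  rw [sum_comm]
  calc ∑ j : Fin K, ∑ t ∈ Icc a T, lagVec K x t j ^ 2
      ≤ ∑ _j : Fin K, ∑ t ∈ Icc b T, x t ^ 2 := sum_le_sum fun j _ =>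
        sum_lag_le (f := fun t => x t ^ 2) (fun t => sq_nonneg _) (by have := j.2; omega)
    _ = _ := by simp

/-- The autoregressive filter is bounded in mean square. This is used both for the first-stage error
and, read backwards, to bound the Gram matrix below. -/
lemma sum_sq_residual_le (hρ : ∀ j, |ρ j| ≤ A) (x : ℕ → ℝ) {a b : ℕ} (h : b + K ≤ a) :
    ∑ t ∈ Icc a T, residual ρ x t ^ 2 ≤ 2 * (1 + K ^ 2 * A ^ 2) * ∑ t ∈ Icc b T, x t ^ 2 := by
  have h1 : ∑ t ∈ Icc a T, x t ^ 2 ≤ ∑ t ∈ Icc b T, x t ^ 2 :=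
    sum_le_sum_of_subset_of_nonneg (Icc_subset_Icc_left (by omega)) fun _ _ _ => sq_nonneg _
  have h2 := sum_sum_sq_lagVec_le (K := K) (T := T) x h
  calc ∑ t ∈ Icc a T, residual ρ x t ^ 2
      ≤ ∑ t ∈ Icc a T, (2 * x t ^ 2 + 2 * (K * A ^ 2 * ∑ j, lagVec K x t j ^ 2)) := by
        refine sum_le_sum fun t _ => ?_
        have h3 := sq_dotProduct_le hρ (lagVec K x t)
        rw [residual]
        nlinarith [sq_nonneg (x t + lagVec K x t ⬝ᵥ ρ)]
    _ = 2 * ∑ t ∈ Icc a T, x t ^ 2 +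
          2 * (K * A ^ 2) * ∑ t ∈ Icc a T, ∑ j : Fin K, lagVec K x t j ^ 2 := by
        rw [sum_add_distrib, mul_sum, mul_sum]
        simp_rw [mul_assoc]
    _ ≤ 2 * ∑ t ∈ Icc b T, x t ^ 2 + 2 * (K * A ^ 2) * (K * ∑ t ∈ Icc b T, x t ^ 2) := by gcongr
    _ = _ := by ring

/-- An entrywise error `τ` changes the form by at most `τ * (∑ |v i|) ^ 2`, which is at most `K * τ
* ∑ v i ^ 2`. -/
lemma quadraticForm_lower_bound {W : Fin K → Fin K → ℝ} {m : Fin K → ℝ} {a τ : ℝ}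
    (hm : ∀ i, a ≤ m i) (hW : ∀ i j, |W i j - if i = j then m i else 0| ≤ τ) (v : Fin K → ℝ) :
    (a - K * τ) * ∑ i, v i ^ 2 ≤ ∑ i, ∑ j, v i * v j * W i j := by
  have h1 : ∀ i j, (if i = j then v i * v j * m i else 0) - τ * (|v i| * |v j|) ≤
      v i * v j * W i j := fun i j => by
    have h2 : |v i * v j * (W i j - if i = j then m i else 0)| ≤ |v i| * |v j| * τ := by
      rw [abs_mul, abs_mul]
      have := hW i j
      gcongr
    have h3 := neg_abs_le (v i * v j * (W i j - if i = j then m i else 0))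
    split_ifs at * <;> nlinarith
  have h4 : (∑ i, |v i|) ^ 2 ≤ K * ∑ i, v i ^ 2 := by
    have := sq_sum_le_card_mul_sum_sq (s := univ) (f := fun i => |v i|)
    simpa using this
  have h5 : ∑ i, a * v i ^ 2 ≤ ∑ i, v i * v i * m i := sum_le_sum fun i _ => by
    nlinarith [hm i, sq_nonneg (v i)]
  have h6 : ∑ i, ∑ j, ((if i = j then v i * v j * m i else 0) - τ * (|v i| * |v j|)) =
      ∑ i, v i * v i * m i - τ * (∑ i, |v i|) ^ 2 := by
    rw [sq, sum_mul_sum, mul_sum]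
    simp only [sum_sub_distrib, sum_ite_eq, mem_univ, if_true, mul_sum]
  have h7 : ∑ i, ∑ j, ((if i = j then v i * v j * m i else 0) - τ * (|v i| * |v j|)) ≤
      ∑ i, ∑ j, v i * v j * W i j := sum_le_sum fun i _ => sum_le_sum fun j _ => h1 i j
  rw [h6] at h7
  rw [← mul_sum] at h5
  rcases isEmpty_or_nonempty (Fin K) with hK | ⟨⟨i⟩⟩
  · simp
  · have hτ : 0 ≤ τ := (abs_nonneg _).trans (hW i i)
    nlinarith

/-- If the autoregressive residuals are approximately uncorrelated, the sample second moment
matrix of the lags is bounded below. -/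
lemma gram_lower_bound (hρ : ∀ j, |ρ j| ≤ A) (x : ℕ → ℝ) {m : Fin K → ℝ} {a τ : ℝ}
    (hm : ∀ i, a ≤ m i)
    (hW : ∀ i j : Fin K, |∑ t ∈ Icc (2 * K + 1) T,
      residual ρ x (t - (i + 1)) * residual ρ x (t - (j + 1)) - if i = j then m i else 0| ≤ τ)
    (v : Fin K → ℝ) :
    (a - K * τ) * ∑ i, v i ^ 2 ≤
      2 * (1 + K ^ 2 * A ^ 2) * ∑ t ∈ Icc (K + 1) T, (lagVec K x t ⬝ᵥ v) ^ 2 := by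
  -- The quadratic form is the sum of squares of the filtered series `x_t'v`. The window starts at
  -- `2 * K + 1` so that all its lags stay in `Icc (K + 1) T`.
  refine (quadraticForm_lower_bound hm hW v).trans (le_trans (le_of_eq ?_)
    (sum_sq_residual_le hρ (fun s => lagVec K x s ⬝ᵥ v) (a := 2 * K + 1) (by omega)))
  simp_rw [residual_lagVec_dotProduct, sq, sum_mul_sum, mul_sum]
  conv_rhs => rw [sum_comm]
  refine sum_congr rfl fun i _ => ?_
  rw [sum_comm]
  exact sum_congr rfl fun t _ => sum_congr rfl fun j _ => by ring

lemma sum_vecMulVec_mulVec (s : Finset ℕ) (x : ℕ → Fin K → ℝ) (v : Fin K → ℝ) :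
    (∑ t ∈ s, vecMulVec (x t) (x t)) *ᵥ v = ∑ t ∈ s, (x t ⬝ᵥ v) • x t := by
  rw [Matrix.sum_mulVec]
  refine sum_congr rfl fun t _ => ?_
  rw [vecMulVec_mulVec]
  simp

/-- The error of the least squares estimate in terms of the normal equations. -/
lemma sum_sq_olsAR_sub_le (x : ℕ → ℝ) {l : ℝ} (hl : 0 < l)
    (hG : ∀ v : Fin K → ℝ, l * ∑ i, v i ^ 2 ≤ ∑ t ∈ Icc (K + 1) T, (lagVec K x t ⬝ᵥ v) ^ 2) :
    ∑ i, (olsAR K T x i - ρ i) ^ 2 ≤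
      ∑ i : Fin K, ((∑ t ∈ Icc (K + 1) T, lagVec K x t i * residual ρ x t) / l) ^ 2 := by
  set G := ∑ t ∈ Icc (K + 1) T, vecMulVec (lagVec K x t) (lagVec K x t) with hGdef
  have hquad : ∀ v, v ⬝ᵥ (G *ᵥ v) = ∑ t ∈ Icc (K + 1) T, (lagVec K x t ⬝ᵥ v) ^ 2 := fun v => by
    rw [hGdef, sum_vecMulVec_mulVec, dotProduct_sum]
    refine sum_congr rfl fun t _ => ?_
    rw [dotProduct_smul, dotProduct_comm v, smul_eq_mul, sq]
  -- The lower bound excludes a kernel, so the matrix inverse in `olsAR` is a genuine one and the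
  -- normal equations hold.
  have hdet : IsUnit G.det := by
    rw [isUnit_iff_ne_zero]
    intro h0
    obtain ⟨v, hv, hGv⟩ := Matrix.exists_mulVec_eq_zero_iff.2 h0
    have h1 := hG v
    rw [← hquad, hGv, dotProduct_zero] at h1
    have h2 : 0 ≤ ∑ i, v i ^ 2 := sum_nonneg fun _ _ => sq_nonneg _
    have h3 : ∑ i, v i ^ 2 = 0 := by nlinarith
    refine hv (funext fun i => ?_)
    have := (sum_eq_zero_iff_of_nonneg fun i _ => sq_nonneg (v i)).1 h3 i (mem_univ i)
    simpa using this
  set d : Fin K → ℝ := fun i => olsAR K T x i - ρ i with hd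
  have hGd : G *ᵥ d = ∑ t ∈ Icc (K + 1) T, residual ρ x t • lagVec K x t := by
    have h1 : d = olsAR K T x - ρ := rfl
    rw [h1, mulVec_sub, olsAR, mulVec_mulVec, ← hGdef, Matrix.mul_nonsing_inv _ hdet, one_mulVec,
      hGdef, sum_vecMulVec_mulVec, ← sum_sub_distrib]
    refine sum_congr rfl fun t _ => ?_
    rw [residual, sub_smul]
  have h1 : l * ∑ i, d i ^ 2 ≤
      ∑ i, d i * ∑ t ∈ Icc (K + 1) T, lagVec K x t i * residual ρ x t := by
    refine (hG d).trans (le_of_eq ?_)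
    rw [← hquad, hGd]
    refine sum_congr rfl fun i _ => ?_
    rw [Finset.sum_apply]
    congr 1
    exact sum_congr rfl fun t _ => by simp [mul_comm]
  set S : Fin K → ℝ := fun i => ∑ t ∈ Icc (K + 1) T, lagVec K x t i * residual ρ x t with hS
  -- Young's inequality, balanced so that half of `l * ∑ d i ^ 2` is absorbed on the left.
  have h2 : ∑ i, d i * S i ≤ ∑ i, (l / 2 * d i ^ 2 + l / 2 * (S i / l) ^ 2) :=
    sum_le_sum fun i _ => by
      have h3 : S i = l * (S i / l) := by field_simp
      set y := S i / l
      rw [h3]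
      nlinarith [mul_nonneg hl.le (sq_nonneg (d i - y))]
  rw [sum_add_distrib, ← mul_sum, ← mul_sum] at h2
  change ∑ i, d i ^ 2 ≤ ∑ i, (S i / l) ^ 2
  change l * ∑ i, d i ^ 2 ≤ ∑ i, d i * S i at h1
  nlinarith

/-- Stability of sums of products under perturbations that are small in mean square. -/
lemma abs_sum_mul_sub_sum_mul_le (s : Finset ℕ) {a b p q : ℕ → ℝ} {V D : ℝ} (hD : 0 ≤ D)
    (ha : ∑ t ∈ s, a t ^ 2 ≤ V) (hb : ∑ t ∈ s, b t ^ 2 ≤ V) (hp : ∑ t ∈ s, p t ^ 2 ≤ D)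
    (hq : ∑ t ∈ s, q t ^ 2 ≤ D) :
    |∑ t ∈ s, (a t - p t) * (b t - q t) - ∑ t ∈ s, a t * b t| ≤ 2 * √(V * D) + D := by
  have hV : 0 ≤ V := (sum_nonneg fun _ _ => sq_nonneg _).trans ha
  have cs : ∀ {f g : ℕ → ℝ} {X Y : ℝ}, 0 ≤ X → ∑ t ∈ s, f t ^ 2 ≤ X → ∑ t ∈ s, g t ^ 2 ≤ Y →
      |∑ t ∈ s, f t * g t| ≤ √(X * Y) := fun {f g X Y} hX hf hg => by
    refine Real.abs_le_sqrt ((sum_mul_sq_le_sq_mul_sq s f g).trans ?_)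
    have : 0 ≤ ∑ t ∈ s, g t ^ 2 := sum_nonneg fun _ _ => sq_nonneg _
    gcongr
  have h1 := cs hV ha hq
  have h2 := cs hD hp hb
  have h3 := cs hD hp hq
  rw [mul_comm D V] at h2
  rw [Real.sqrt_mul_self hD] at h3
  have h4 : ∑ t ∈ s, (a t - p t) * (b t - q t) - ∑ t ∈ s, a t * b t =
      -∑ t ∈ s, a t * q t - ∑ t ∈ s, p t * b t + ∑ t ∈ s, p t * q t := by
    rw [← sum_neg_distrib, ← sum_sub_distrib, ← sum_sub_distrib, ← sum_add_distrib]
    exact sum_congr rfl fun t _ => by ring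
  rw [h4]
  rw [abs_le] at *
  constructor <;> linarith [h1.1, h1.2, h2.1, h2.2, h3.1, h3.2]

/-- The lags of `Y - Ĉ` and of `Y - C` differ by minus the lags of `Ĉ - C`, so the first-stage
errors combine into an autoregressive residual. -/
lemma proxyHat_sub_proxy (Y C Chat : ℕ → ℝ) (ρ : Fin K → ℝ) (t : ℕ) :
    proxyHat K T Y Chat t - proxy Y C ρ t = residual ρ (fun s => Chat s - C s) t +
      lagVec K (fun s => Y s - Chat s) t ⬝ᵥ
        fun j => olsAR K T (fun s => Y s - Chat s) j - ρ j := by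
  simp only [proxyHat, proxy, residual, lagVec, dotProduct, mul_sub, sub_mul, sum_sub_distrib]
  ring

end LeastSquares

/-! ### Tail bounds by doubling the level. -/

section Stationary

/-- The quantity `F M - 2 * b / M ^ 2` does not decrease when `M` is doubled, and along doublings
its limit is zero. No rate for `F` is needed, so the bound depends on `b` alone. -/
lemma le_of_doubling {F : ℝ → ℝ} {b : ℝ} (hb : 0 ≤ b) (hF : Tendsto F atTop (𝓝 0))
    (h : ∀ M, 0 < M → F M ≤ F (2 * M) + b / M ^ 2) {M : ℝ} (hM : 0 < M) :
    F M ≤ 2 * b / M ^ 2 := by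
  have h1 : ∀ n : ℕ, F M - 2 * b / M ^ 2 ≤ F (2 ^ n * M) - 2 * b / (2 ^ n * M) ^ 2 := fun n => by
    induction n with
    | zero => simp
    | succ n ih =>
      refine ih.trans ?_
      have h2 := h (2 ^ n * M) (by positivity)
      have h3 : (2 : ℝ) ^ (n + 1) * M = 2 * (2 ^ n * M) := by ring
      rw [h3]
      set N := 2 ^ n * M with hN
      have hN0 : 0 < N := by positivity
      have h4 : 2 * b / (2 * N) ^ 2 = 2⁻¹ * (b / N ^ 2) := by
        field_simp
      have h5 : 2 * b / N ^ 2 = 2 * (b / N ^ 2) := by ring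
      have h6 : 0 ≤ b / N ^ 2 := by positivity
      rw [h4, h5]
      linarith
  have h2 : Tendsto (fun n : ℕ => F (2 ^ n * M)) atTop (𝓝 0) :=
    hF.comp ((tendsto_pow_atTop_atTop_of_one_lt one_lt_two).atTop_mul_const hM)
  have h3 : F M - 2 * b / M ^ 2 ≤ 0 := ge_of_tendsto' h2 fun n => (h1 n).trans (by
    have : 0 ≤ 2 * b / (2 ^ n * M) ^ 2 := by positivity
    linarith)
  linarith

lemma tendsto_measureReal_norm_gt {Ω E : Type*} [MeasurableSpace Ω] {μ : Measure Ω}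
    [IsProbabilityMeasure μ] [NormedAddCommGroup E] [CompleteSpace E] [SecondCountableTopology E]
    [MeasurableSpace E] [BorelSpace E] {f : Ω → E} (hf : Measurable f) :
    Tendsto (fun M : ℝ => μ.real {ω | M < ‖f ω‖}) atTop (𝓝 0) := by
  have h1 := tendsto_measure_norm_gt_of_isTightMeasureSet
    (isTightMeasureSet_singleton (μ := μ.map f))
  have h2 : ∀ M : ℝ, (μ.map f) {x | M < ‖x‖} = μ {ω | M < ‖f ω‖} := fun M =>
    Measure.map_apply hf (measurableSet_lt measurable_const measurable_norm)
  simp only [Set.mem_singleton_iff, iSup_iSup_eq_left, h2] at h1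
  exact (ENNReal.tendsto_toReal ENNReal.zero_ne_top).comp h1

end Stationary

/-! ### Stochastic bounds for the stable autoregression. -/

section Model

/-- The sum of the absolute initial values. -/
noncomputable def initSum (K : ℕ) (x : ℕ → ℝ) : ℝ := ∑ t ∈ Icc 1 K, |x t|

lemma initSum_nonneg (K : ℕ) (x : ℕ → ℝ) : 0 ≤ initSum K x :=
  sum_nonneg fun _ _ => abs_nonneg _

/-- A series `e` driven by the noise `u` through a stable autoregression with coefficients `ρ`,
together with its moving average weights `w`, and constants that control all of these. -/
structure IsStableAR {Ω : Type*} [MeasurableSpace Ω] (μ : Measure Ω) (K T : ℕ)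
    (e u : ℕ → Ω → ℝ) (ρ : Fin K → ℝ) (w : ℕ → ℝ) (A s M : ℝ) : Prop where
  noise : IsNoise μ T u M
  measurable : ∀ t, Measurable (e t)
  coeff : ∀ j, |ρ j| ≤ A
  weight : ∀ k, |w k| ≤ A * s ^ k
  residual_eq : ∀ t ∈ Icc (K + 1) T, ∀ ω, residual ρ (fun r => e r ω) t = u t ω
  approx : ∀ ω, ∀ B : ℝ, 0 ≤ B → (∀ t ∈ Icc 1 K, |e t ω| ≤ B) → ∀ t ∈ Icc 1 T,
    |e t ω - movingAverage K w (fun r => u r ω) t| ≤ A * B * s ^ t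

namespace IsStableAR

variable {Ω : Type*} [MeasurableSpace Ω] {μ : Measure Ω} {K T : ℕ}
  {e u : ℕ → Ω → ℝ} {ρ : Fin K → ℝ} {w : ℕ → ℝ} {A s M : ℝ}

lemma approx_initSum (hm : IsStableAR μ K T e u ρ w A s M) (ω : Ω) {t : ℕ} (ht : t ∈ Icc 1 T) :
    |e t ω - movingAverage K w (fun r => u r ω) t| ≤ A * initSum K (fun r => e r ω) * s ^ t :=
  hm.approx ω _ (initSum_nonneg _ _) (fun _ ht =>
    single_le_sum (f := fun t => |e t ω|) (fun _ _ => abs_nonneg _) ht) t ht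

variable [IsProbabilityMeasure μ]

/-- By stationarity the initial vector may be moved `n` steps ahead, where initial values below `2 *
B` contribute at most `B / 2`. Exceeding `B` then requires an initial vector beyond `2 * B` or a
moving average beyond `B / 2`. Chebyshev's inequality for the latter gives the hypothesis of
`le_of_doubling`. -/
lemma tail_le_of_stationary (hm : IsStableAR μ K T e u ρ w A s M)
    (hA : 0 ≤ A) (hs0 : 0 ≤ s) (hs1 : s < 1) (hM : 0 ≤ M) {n : ℕ} (hn : A * s ^ n ≤ 1 / 4)
    (hnT : K + n ≤ T) (hst : IsStationaryUpTo μ T e) {B : ℝ} (hB : 0 < B) :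
    μ.real {ω | B < ‖fun i : Fin K => e (i + 1) ω‖} ≤
      2 * (K * (4 * ((A / (1 - s)) ^ 2 * (1 + M)))) / B ^ 2 := by
  set b := (A / (1 - s)) ^ 2 * (1 + M) with hb
  have hb0 : 0 ≤ b := by positivity
  have he := hm.measurable
  refine le_of_doubling (F := fun B => μ.real {ω | B < ‖fun i : Fin K => e (i + 1) ω‖})
    (by positivity) (tendsto_measureReal_norm_gt (by fun_prop)) (fun B hB => ?_) hB
  have h1 : μ {ω | B < ‖fun i : Fin K => e (i + 1) ω‖} =
      μ {ω | B < ‖fun i : Fin K => e (i + 1 + n) ω‖} :=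
    ((hst K n hnT).measure_mem_eq (s := {x | B < ‖x‖})
      (measurableSet_lt measurable_const measurable_norm)).symm
  have h2 : {ω | B < ‖fun i : Fin K => e (i + 1 + n) ω‖} ⊆
      {ω | 2 * B < ‖fun i : Fin K => e (i + 1) ω‖} ∪ ⋃ i : Fin K,
        {ω | B ^ 2 / 4 < movingAverage K w (fun r => u r ω) (i + 1 + n) ^ 2} := by
    intro ω hω
    by_contra hcon
    simp only [Set.mem_union, Set.mem_iUnion, Set.mem_ofPred_eq, not_or, not_lt, not_exists]
      at hcon hω
    refine absurd ((pi_norm_le_iff_of_nonneg hB.le).2 fun i => ?_) (not_le.2 hω)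
    have hi := i.2
    have h3 := hm.approx ω (2 * B) (by positivity) (fun t ht => by
      rw [mem_Icc] at ht
      have := (pi_norm_le_iff_of_nonneg (by positivity)).1 hcon.1 ⟨t - 1, by omega⟩
      simpa [Nat.sub_add_cancel ht.1] using this) (i + 1 + n) (mem_Icc.2 ⟨by omega, by omega⟩)
    have h4 : A * (2 * B) * s ^ ((i : ℕ) + 1 + n) ≤ A * (2 * B) * s ^ n :=
      mul_le_mul_of_nonneg_left (pow_le_pow_of_le_one hs0 hs1.le (by omega)) (by positivity)
    have h5 : A * (2 * B) * s ^ n ≤ B / 2 := by nlinarith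
    have h6 := Real.abs_le_sqrt (hcon.2 i)
    have h7 : √(B ^ 2 / 4) = B / 2 := by
      rw [show B ^ 2 / 4 = (B / 2) ^ 2 by ring, Real.sqrt_sq (by positivity)]
    rw [h7] at h6
    rw [Real.norm_eq_abs]
    rw [abs_le] at *
    constructor <;> linarith [h3.1, h3.2, h6.1, h6.2]
  have h3 : ∀ i : Fin K,
      μ.real {ω | B ^ 2 / 4 < movingAverage K w (fun r => u r ω) (i + 1 + n) ^ 2} ≤
        4 * b / B ^ 2 := fun i => by
    have hi := i.2
    have h4 := measure_lt_le_of_integral_le (μ := μ) (a := B ^ 2 / 4)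
      (hm.noise.memLp_movingAverage (K := K) (h := w) (t := i + 1 + n) (by omega)).integrable_sq
      (fun _ => sq_nonneg _) (by positivity)
      (hm.noise.integral_sq_movingAverage_le hM hA hs0 hs1 hm.weight (by omega))
    have h5 := ENNReal.toReal_le_of_le_ofReal (by positivity) h4
    refine h5.trans (le_of_eq ?_)
    rw [← hb]
    field_simp
  calc μ.real {ω | B < ‖fun i : Fin K => e (i + 1) ω‖}
      = μ.real {ω | B < ‖fun i : Fin K => e (i + 1 + n) ω‖} := by rw [measureReal_def, h1]; rfl
    _ ≤ _ := measureReal_mono h2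
    _ ≤ _ := measureReal_union_le _ _
    _ ≤ μ.real {ω | 2 * B < ‖fun i : Fin K => e (i + 1) ω‖} + ∑ i : Fin K,
          μ.real {ω | B ^ 2 / 4 < movingAverage K w (fun r => u r ω) (i + 1 + n) ^ 2} := by
        gcongr
        exact measureReal_iUnion_fintype_le _
    _ ≤ μ.real {ω | 2 * B < ‖fun i : Fin K => e (i + 1) ω‖} + ∑ _i : Fin K, 4 * b / B ^ 2 := by
        gcongr with i
        exact h3 i
    _ = _ := by
        rw [sum_const, card_univ, Fintype.card_fin, nsmul_eq_mul]
        ring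

end IsStableAR

variable {Ω : ℕ → Type*} [∀ T, MeasurableSpace (Ω T)] {P : ∀ T, Measure (Ω T)}
  [∀ T, IsProbabilityMeasure (P T)] {K : ℕ} {e u : ∀ T, ℕ → Ω T → ℝ} {ρ : ℕ → Fin K → ℝ}
  {w : ℕ → ℕ → ℝ} {A s M : ℝ}

lemma isBoundedInProb_initSum_of_stationary
    (hm : ∀ T, IsStableAR (P T) K T (e T) (u T) (ρ T) (w T) A s M)
    (hA : 0 ≤ A) (hs0 : 0 ≤ s) (hs1 : s < 1) (hM : 0 ≤ M)
    (hst : ∀ T, IsStationaryUpTo (P T) T (e T)) :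
    IsBoundedInProb P fun T ω => initSum K fun t => e T t ω := by
  have key : IsBoundedInProb P fun T ω => ‖fun i : Fin K => e T (i + 1) ω‖ := by
    -- The shift `n` depends only on `A` and `s`, hence the tail bound is uniform over all large
    -- `T`.
    obtain ⟨n, hn⟩ : ∃ n : ℕ, A * s ^ n ≤ 1 / 4 := by
      have h1 : Tendsto (fun n : ℕ => A * s ^ n) atTop (𝓝 (A * 0)) :=
        (tendsto_pow_atTop_nhds_zero_of_lt_one hs0 hs1).const_mul A
      rw [mul_zero] at h1
      exact (h1.eventually_le_const (by norm_num)).exists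
    intro η hη
    set b := 2 * (K * (4 * ((A / (1 - s)) ^ 2 * (1 + M)))) with hb
    have hb0 : 0 ≤ b := by positivity
    have hpos : 0 < √((b + 1) / η) := Real.sqrt_pos.2 (by positivity)
    refine ⟨√((b + 1) / η), ?_⟩
    filter_upwards [eventually_ge_atTop (K + n)] with T hT
    have h1 := (hm T).tail_le_of_stationary hA hs0 hs1 hM hn hT (hst T) hpos
    rw [← hb, Real.sq_sqrt (by positivity), div_div_eq_mul_div] at h1
    simp only [abs_norm]
    rw [← ENNReal.ofReal_toReal (measure_ne_top (P T) _)]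
    refine ENNReal.ofReal_le_ofReal (h1.trans ?_)
    rw [div_le_iff₀ (by positivity), mul_comm]
    gcongr
    linarith
  refine isBoundedInProb_of_imp key key fun B hB => ⟨K * B, Eventually.of_forall fun T ω h1 _ => ?_⟩
  rw [abs_of_nonneg (initSum_nonneg _ _)]
  rw [abs_norm] at h1
  have h2 : ∀ t ∈ Icc 1 K, |e T t ω| ≤ B := fun t ht => by
    rw [mem_Icc] at ht
    have := (pi_norm_le_iff_of_nonneg hB).1 h1 ⟨t - 1, by omega⟩
    simpa [Nat.sub_add_cancel ht.1] using this
  refine (sum_le_card_nsmul _ _ _ h2).trans (le_of_eq ?_)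
  simp

lemma isBoundedInProb_apply (hm : ∀ T, IsStableAR (P T) K T (e T) (u T) (ρ T) (w T) A s M)
    (hA : 0 ≤ A) (hs0 : 0 ≤ s) (hs1 : s < 1) (hM : 0 ≤ M)
    (hI : IsBoundedInProb P fun T ω => initSum K fun t => e T t ω) {t : ℕ → ℕ}
    (ht : ∀ᶠ T in atTop, t T ∈ Icc 1 T) : IsBoundedInProb P fun T ω => e T (t T) ω := by
  have h1 : IsBoundedInProb P fun T ω => movingAverage K (w T) (fun r => u T r ω) (t T) := by
    refine IsBoundedInProb.of_sq (isBoundedInProb_of_integral_le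
      (b := (A / (1 - s)) ^ 2 * (1 + M)) ?_)
    filter_upwards [ht] with T hT
    rw [mem_Icc] at hT
    exact ⟨((hm T).noise.memLp_movingAverage hT.2).integrable_sq, fun _ => sq_nonneg _,
      (hm T).noise.integral_sq_movingAverage_le hM hA hs0 hs1 (hm T).weight hT.2⟩
  refine isBoundedInProb_of_imp hI h1 fun B hB => ⟨A * B + B, ?_⟩
  filter_upwards [ht] with T hT ω h2 h3
  rw [abs_of_nonneg (initSum_nonneg _ _)] at h2
  have h4 := (hm T).approx_initSum ω hT
  have h5 : A * initSum K (fun r => e T r ω) * s ^ t T ≤ A * B * 1 := by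
    have := initSum_nonneg K (fun r => e T r ω)
    have := pow_le_one₀ (n := t T) hs0 hs1.le
    gcongr
  rw [abs_le] at *
  constructor <;> linarith [h4.1, h4.2, h3.1, h3.2]

/-- The effect of the initial values decays geometrically, so its total square is bounded
independently of `T`. -/
lemma sum_sq_sub_movingAverage_le {Ω : Type*} [MeasurableSpace Ω] {μ : Measure Ω} {T : ℕ}
    {e u : ℕ → Ω → ℝ} {ρ : Fin K → ℝ} {w : ℕ → ℝ} (hm : IsStableAR μ K T e u ρ w A s M)
    (hs0 : 0 ≤ s) (hs1 : s < 1) (ω : Ω) :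
    ∑ t ∈ Icc 1 T, (e t ω - movingAverage K w (fun r => u r ω) t) ^ 2 ≤
      (A * initSum K fun r => e r ω) ^ 2 * (1 / (1 - s)) := by
  set I := initSum K fun r => e r ω
  have h1 : ∑ t ∈ Icc 1 T, s ^ t ≤ 1 / (1 - s) := by
    rw [one_div, ← tsum_geometric_of_lt_one hs0 hs1]
    exact (summable_geometric_of_lt_one hs0 hs1).sum_le_tsum _ fun _ _ => by positivity
  calc _ ≤ ∑ t ∈ Icc 1 T, (A * I) ^ 2 * s ^ t := sum_le_sum fun t ht => by
        have h2 := (hm.approx_initSum ω ht)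
        rw [← sq_abs]
        calc _ ≤ (A * I * s ^ t) ^ 2 := by gcongr
          _ = (A * I) ^ 2 * (s ^ t * s ^ t) := by ring
          _ ≤ (A * I) ^ 2 * (s ^ t * 1) := by
            have := pow_le_one₀ (n := t) hs0 hs1.le
            gcongr
          _ = _ := by ring
    _ = (A * I) ^ 2 * ∑ t ∈ Icc 1 T, s ^ t := by rw [mul_sum]
    _ ≤ _ := by gcongr

lemma isBoundedInProb_sum_sq_noise {u : ∀ T, ℕ → Ω T → ℝ} (hu : ∀ T, IsNoise (P T) T (u T) M)
    (hM : 0 ≤ M) : IsBoundedInProb P fun T ω => (∑ t ∈ Icc (K + 1) T, u T t ω ^ 2) / T := by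
  refine isBoundedInProb_of_integral_le (b := 1 + M) ?_
  filter_upwards [eventually_gt_atTop 0] with T hT
  have hT' : (0 : ℝ) < T := by exact_mod_cast hT
  have hmem : ∀ t ∈ Icc (K + 1) T, t ∈ Icc 1 T := fun t ht => by
    simp only [mem_Icc] at *
    omega
  have hint : ∀ t ∈ Icc (K + 1) T, Integrable (fun ω => u T t ω ^ 2) (P T) := fun t ht =>
    ((hu T).memLp_two (hmem t ht)).integrable_sq
  refine ⟨(integrable_finsetSum _ hint).div_const _, fun ω => by positivity, ?_⟩
  rw [integral_div, integral_finsetSum _ hint, div_le_iff₀ hT', mul_comm]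
  refine (sum_le_card_nsmul _ _ _ fun t ht => (hu T).integral_sq_le (hmem t ht)).trans ?_
  rw [nsmul_eq_mul]
  gcongr
  rw [Nat.card_Icc]
  omega

lemma isBoundedInProb_sum_sq (hm : ∀ T, IsStableAR (P T) K T (e T) (u T) (ρ T) (w T) A s M)
    (hA : 0 ≤ A) (hs0 : 0 ≤ s) (hs1 : s < 1) (hM : 0 ≤ M)
    (hI : IsBoundedInProb P fun T ω => initSum K fun t => e T t ω) :
    IsBoundedInProb P fun T ω => (∑ t ∈ Icc 1 T, e T t ω ^ 2) / T := by
  have h1 : IsBoundedInProb P fun T ω =>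
      (∑ t ∈ Icc 1 T, movingAverage K (w T) (fun r => u T r ω) t ^ 2) / T := by
    refine isBoundedInProb_of_integral_le (b := (A / (1 - s)) ^ 2 * (1 + M)) ?_
    filter_upwards [eventually_gt_atTop 0] with T hT
    have hT' : (0 : ℝ) < T := by exact_mod_cast hT
    have hint : ∀ t ∈ Icc 1 T,
        Integrable (fun ω => movingAverage K (w T) (fun r => u T r ω) t ^ 2) (P T) := fun t ht =>
      ((hm T).noise.memLp_movingAverage (mem_Icc.1 ht).2).integrable_sq
    refine ⟨(integrable_finsetSum _ hint).div_const _, fun ω => by positivity, ?_⟩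
    rw [integral_div, integral_finsetSum _ hint, div_le_iff₀ hT', mul_comm]
    refine (sum_le_card_nsmul _ _ _ fun t ht =>
      (hm T).noise.integral_sq_movingAverage_le hM hA hs0 hs1 (hm T).weight
        (mem_Icc.1 ht).2).trans ?_
    simp
  refine isBoundedInProb_of_imp hI h1 fun B hB => ⟨2 * ((A * B) ^ 2 * (1 / (1 - s))) + 2 * B, ?_⟩
  filter_upwards [eventually_gt_atTop 0] with T hT ω h2 h3
  have hT' : (1 : ℝ) ≤ T := by exact_mod_cast hT
  have hT0 : (0 : ℝ) < T := by positivity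
  rw [abs_of_nonneg (initSum_nonneg _ _)] at h2
  rw [abs_of_nonneg (by positivity), div_le_iff₀ hT0] at h3 ⊢
  have h4 := sum_sq_sub_movingAverage_le (hm T) hs0 hs1 ω
  have h5 : (A * initSum K fun r => e T r ω) ^ 2 * (1 / (1 - s)) ≤
      (A * B) ^ 2 * (1 / (1 - s)) * T := by
    have h6 : 0 < 1 - s := by linarith
    have h7 := initSum_nonneg K (fun r => e T r ω)
    calc _ ≤ (A * B) ^ 2 * (1 / (1 - s)) * 1 := by rw [mul_one]; gcongr
      _ ≤ _ := by gcongr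
  have h8 : ∑ t ∈ Icc 1 T, e T t ω ^ 2 ≤
      2 * ∑ t ∈ Icc 1 T, (e T t ω - movingAverage K (w T) (fun r => u T r ω) t) ^ 2 +
      2 * ∑ t ∈ Icc 1 T, movingAverage K (w T) (fun r => u T r ω) t ^ 2 := by
    rw [mul_sum, mul_sum, ← sum_add_distrib]
    exact sum_le_sum fun t _ => by
      nlinarith [sq_nonneg (e T t ω - 2 * movingAverage K (w T) (fun r => u T r ω) t)]
  nlinarith

lemma tendsto_const_div_natCast (b : ℝ) : Tendsto (fun T : ℕ => b / T) atTop (𝓝 0) :=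
  tendsto_const_nhds.div_atTop tendsto_natCast_atTop_atTop

/-- The lag is split into its moving average, whose normalized sum has second moment of order `1 /
T` by orthogonality, and the effect of the initial values, which Cauchy-Schwarz handles because its
total square is `O_P(1)`. -/
lemma isLittleOP_sum_lag_mul_noise
    (hm : ∀ T, IsStableAR (P T) K T (e T) (u T) (ρ T) (w T) A s M)
    (hA : 0 ≤ A) (hs0 : 0 ≤ s) (hs1 : s < 1) (hM : 0 ≤ M)
    (hI : IsBoundedInProb P fun T ω => initSum K fun t => e T t ω) (j : Fin K) :
    IsLittleOP P (fun T ω => (∑ t ∈ Icc (K + 1) T, e T (t - (j + 1)) ω * u T t ω) / T)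
      fun _ => 1 := by
  have hj := j.2
  have h1 : IsLittleOP P (fun T ω => (∑ t ∈ Icc (K + 1) T,
      movingAverage K (w T) (fun r => u T r ω) (t - (j + 1)) * u T t ω) / T) fun _ => 1 := by
    refine IsLittleOP.of_sq (isLittleOP_of_integral_le
      (tendsto_const_div_natCast ((A / (1 - s)) ^ 2 * M)) ?_)
    filter_upwards [eventually_gt_atTop 0] with T hT
    have hT' : (0 : ℝ) < T := by exact_mod_cast hT
    simp only [div_pow]
    refine ⟨((hm T).noise.integrable_sq_sum_movingAverage_mul (by omega)).div_const _,
      fun ω => by positivity, ?_⟩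
    rw [integral_div, div_le_iff₀ (by positivity)]
    refine ((hm T).noise.integral_sq_sum_movingAverage_mul_le hM hA hs0 hs1 (hm T).weight
      (by omega)).trans (le_of_eq ?_)
    field_simp
  have h2 : IsLittleOP P (fun T ω => (∑ t ∈ Icc (K + 1) T,
      (e T (t - (j + 1)) ω - movingAverage K (w T) (fun r => u T r ω) (t - (j + 1))) *
        u T t ω) / T) fun _ => 1 := by
    have h3 : IsLittleOP P (fun T (_ : Ω T) => (1 : ℝ) / T) fun _ => 1 := by
      refine isLittleOP_of_integral_le (tendsto_const_div_natCast 1)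
        (Eventually.of_forall fun T => ⟨integrable_const _, fun _ => by positivity, ?_⟩)
      simp
    -- This product dominates the square of the normalized sum: squared initial values, times the
    -- mean square of the noise, times `1 / T`.
    have h4 := IsBoundedInProb.mul_isLittleOP
      ((isBoundedInProb_const (A ^ 2 * (1 / (1 - s)))).mul
        ((hI.mul hI).mul (isBoundedInProb_sum_sq_noise (K := K) (fun T => (hm T).noise) hM))) h3
    refine IsLittleOP.of_sq (h4.mono (Eventually.of_forall fun T ω => ?_))
    rw [abs_of_nonneg (sq_nonneg _)]
    refine le_trans ?_ (le_abs_self _)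
    have h5 := sum_lag_le (T := T)
      (f := fun t => (e T t ω - movingAverage K (w T) (fun r => u T r ω) t) ^ 2)
      (fun _ => sq_nonneg _) (a := K + 1) (b := 1) (k := j + 1) (by omega)
    have h6 := sum_sq_sub_movingAverage_le (hm T) hs0 hs1 ω
    have h7 := sum_mul_sq_le_sq_mul_sq (Icc (K + 1) T)
      (fun t => e T (t - (j + 1)) ω - movingAverage K (w T) (fun r => u T r ω) (t - (j + 1)))
      (fun t => u T t ω)
    rw [div_pow]
    calc _ ≤ ((A * initSum K fun r => e T r ω) ^ 2 * (1 / (1 - s)) *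
          ∑ t ∈ Icc (K + 1) T, u T t ω ^ 2) / (T : ℝ) ^ 2 := by
          gcongr
          exact h7.trans (mul_le_mul_of_nonneg_right (h5.trans h6)
            (sum_nonneg fun _ _ => sq_nonneg _))
      _ = _ := by
        field_simp
  refine (h1.add h2).mono (Eventually.of_forall fun T ω => le_of_eq ?_)
  rw [← add_div, ← sum_add_distrib]
  congr 2
  exact sum_congr rfl fun t _ => by ring

/-- The sample second moments of the noise at lags in `1, …, K`, up to their means, are
asymptotically negligible. -/
lemma isLittleOP_sum_noise_mul_noise {u : ∀ T, ℕ → Ω T → ℝ}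
    (hu : ∀ T, IsNoise (P T) T (u T) M) (i j : Fin K) :
    IsLittleOP P (fun T ω => (∑ t ∈ Icc (2 * K + 1) T,
      u T (t - (i + 1)) ω * u T (t - (j + 1)) ω -
        if i = j then ∑ t ∈ Icc (2 * K + 1) T, ∫ ω', u T (t - (i + 1)) ω' ^ 2 ∂(P T) else 0) / T)
      fun _ => 1 := by
  have hidx : ∀ (l : Fin K) (T : ℕ), ∀ t ∈ Icc (2 * K + 1) T, t - (l + 1) ∈ Icc 1 T :=
    fun l T t ht => by
      have hl := l.2
      simp only [mem_Icc] at *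
      omega
  have key : ∀ X : ∀ T, Ω T → ℝ, (∀ T, 0 < T → MemLp (X T) 2 (P T) ∧
      ∫ ω, X T ω ^ 2 ∂(P T) ≤ #(Icc (2 * K + 1) T) * M) →
      IsLittleOP P (fun T ω => X T ω / T) fun _ => 1 := fun X hX => by
    refine IsLittleOP.of_sq (isLittleOP_of_integral_le (tendsto_const_div_natCast M) ?_)
    filter_upwards [eventually_gt_atTop 0] with T hT
    have hT' : (0 : ℝ) < T := by exact_mod_cast hT
    have hM : 0 ≤ M := (hu T).nonneg hT
    obtain ⟨h1, h2⟩ := hX T hT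
    simp only [div_pow]
    refine ⟨h1.integrable_sq.div_const _, fun ω => by positivity, ?_⟩
    rw [integral_div, div_le_iff₀ (by positivity)]
    calc _ ≤ _ := h2
      _ ≤ (T : ℝ) * M := by
        gcongr
        rw [Nat.card_Icc]
        omega
      _ = _ := by field_simp
  have hmul : ∀ (i j : Fin K) (T : ℕ), MemLp (fun ω => ∑ t ∈ Icc (2 * K + 1) T,
      u T (t - (i + 1)) ω * u T (t - (j + 1)) ω) 2 (P T) := fun i j T =>
    memLp_finsetSum _ fun t ht => (hu T).memLp_mul (hidx i T t ht) (hidx j T t ht)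
  -- For `i < j` the innovation at lag `i + 1` is the later one and plays the role of `p`.
  have hlt : ∀ i j : Fin K, i < j → IsLittleOP P (fun T ω => (∑ t ∈ Icc (2 * K + 1) T,
      u T (t - (i + 1)) ω * u T (t - (j + 1)) ω) / T) fun _ => 1 := fun i j hij =>
    key _ fun T _ => ⟨hmul i j T, (hu T).integral_sq_sum_mul_le _ (p := fun t => t - (i + 1))
      (q := fun t => t - (j + 1)) (hidx i T) (hidx j T)
      (fun t ht => by
        have hj := j.2
        simp only [mem_Icc, Fin.lt_def] at *
        omega)
      fun t ht t' ht' h => by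
        have hj := j.2
        simp only [mem_Icc, Fin.lt_def] at *
        omega⟩
  rcases lt_trichotomy i j with h | rfl | h
  · simpa [h.ne] using hlt i j h
  · simp only [if_true]
    refine key _ fun T _ => ⟨(hmul i i T).sub (memLp_const _), ?_⟩
    simp only [← sum_sub_distrib]
    exact (hu T).integral_sq_sum_sq_le _ (hidx i T) fun t ht t' ht' h => by
      have hi := i.2
      simp only [mem_Icc] at *
      omega
  · simpa [h.ne', mul_comm] using hlt j i h

end Model

/-! ### Consistency of least squares under observation error. -/

section Consistency

variable {Ω : ℕ → Type*} [∀ T, MeasurableSpace (Ω T)] {P : ∀ T, Measure (Ω T)}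
  [∀ T, IsProbabilityMeasure (P T)] {K : ℕ} {e u δ : ∀ T, ℕ → Ω T → ℝ} {ρ : ℕ → Fin K → ℝ}
  {w : ℕ → ℕ → ℝ} {A s M : ℝ}

/-- Consistency of least squares when the series is observed with an error that is small in mean
square. -/
theorem isLittleOP_sum_sq_olsAR_sub
    (hm : ∀ T, IsStableAR (P T) K T (e T) (u T) (ρ T) (w T) A s M)
    (hA : 0 ≤ A) (hs0 : 0 ≤ s) (hs1 : s < 1) (hM : 0 ≤ M)
    (hI : IsBoundedInProb P fun T ω => initSum K fun t => e T t ω)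
    {v : ℝ} (hv : 0 < v) (hvar : ∀ T, ∀ t ∈ Icc 1 T, v ≤ ∫ ω, u T t ω ^ 2 ∂(P T))
    (hδ : IsLittleOP P (fun T ω => (∑ t ∈ Icc 1 T, δ T t ω ^ 2) / T) fun _ => 1) :
    IsLittleOP P (fun T ω =>
      ∑ i, (olsAR K T (fun t => e T t ω - δ T t ω) i - ρ T i) ^ 2) fun _ => 1 := by
  set c₀ : ℝ := 2 * (1 + K ^ 2 * A ^ 2) with hc₀
  have hc₀1 : 1 ≤ c₀ := by
    have : 0 ≤ (K : ℝ) ^ 2 * A ^ 2 := by positivity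
    linarith
  have hc₀0 : 0 < c₀ := by linarith
  set x : ∀ T, ℕ → Ω T → ℝ := fun T t ω => e T t ω - δ T t ω with hx
  -- `V` bounds the mean squares of `e` and `u`, and `D` those of `δ` and of its residuals. One
  -- perturbation estimate thus serves the normal equations and the Gram matrix alike.
  set V : ∀ T, Ω T → ℝ := fun T ω =>
    (∑ t ∈ Icc 1 T, e T t ω ^ 2) / T + (∑ t ∈ Icc (K + 1) T, u T t ω ^ 2) / T with hV
  set D : ∀ T, Ω T → ℝ := fun T ω => c₀ * ((∑ t ∈ Icc 1 T, δ T t ω ^ 2) / T) with hD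
  have hVO : IsBoundedInProb P V := (isBoundedInProb_sum_sq hm hA hs0 hs1 hM hI).add
    (isBoundedInProb_sum_sq_noise (fun T => (hm T).noise) hM)
  have hDo : IsLittleOP P D fun _ => 1 := IsBoundedInProb.mul_isLittleOP (isBoundedInProb_const c₀) hδ
  have hE : IsLittleOP P (fun T ω => 2 * √(V T ω * D T ω) + D T ω) fun _ => 1 :=
    (IsBoundedInProb.mul_isLittleOP (isBoundedInProb_const 2)
      (IsBoundedInProb.mul_isLittleOP hVO hDo).sqrt).add hDo
  have hD0 : ∀ T ω, 0 ≤ D T ω := fun T ω => by positivity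
  have hpert : ∀ (T : ℕ), 0 < T → ∀ (I : Finset ℕ) (ω : Ω T) (a b p q : ℕ → ℝ),
      ∑ t ∈ I, a t ^ 2 ≤ V T ω * T → ∑ t ∈ I, b t ^ 2 ≤ V T ω * T →
      ∑ t ∈ I, p t ^ 2 ≤ D T ω * T → ∑ t ∈ I, q t ^ 2 ≤ D T ω * T →
      |∑ t ∈ I, (a t - p t) * (b t - q t) - ∑ t ∈ I, a t * b t| ≤
        (2 * √(V T ω * D T ω) + D T ω) * T := fun T hT I ω a b p q ha hb hp hq => by
    refine (abs_sum_mul_sub_sum_mul_le I (mul_nonneg (hD0 T ω) (Nat.cast_nonneg T))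
      ha hb hp hq).trans (le_of_eq ?_)
    rw [show V T ω * T * (D T ω * T) = V T ω * D T ω * (T : ℝ) ^ 2 by ring,
      Real.sqrt_mul' _ (sq_nonneg _), Real.sqrt_sq (Nat.cast_nonneg T)]
    ring
  have hVT : ∀ (T : ℕ), 0 < T → ∀ ω, ∑ t ∈ Icc 1 T, e T t ω ^ 2 ≤ V T ω * T ∧
      ∑ t ∈ Icc (K + 1) T, u T t ω ^ 2 ≤ V T ω * T := fun T hT ω => by
    have hT' : (0 : ℝ) < T := by exact_mod_cast hT
    have h1 : V T ω * T = ∑ t ∈ Icc 1 T, e T t ω ^ 2 + ∑ t ∈ Icc (K + 1) T, u T t ω ^ 2 := by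
      simp only [hV]
      field_simp
    have h2 : 0 ≤ ∑ t ∈ Icc 1 T, e T t ω ^ 2 := sum_nonneg fun _ _ => sq_nonneg _
    have h3 : 0 ≤ ∑ t ∈ Icc (K + 1) T, u T t ω ^ 2 := sum_nonneg fun _ _ => sq_nonneg _
    constructor <;> linarith
  have hDT : ∀ (T : ℕ), 0 < T → ∀ ω, D T ω * T = c₀ * ∑ t ∈ Icc 1 T, δ T t ω ^ 2 :=
    fun T hT ω => by
      have hT' : (0 : ℝ) < T := by exact_mod_cast hT
      simp only [hD]
      field_simp
  have hδT : ∀ (T : ℕ), 0 < T → ∀ ω, ∑ t ∈ Icc 1 T, δ T t ω ^ 2 ≤ D T ω * T ∧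
      ∑ t ∈ Icc (K + 1) T, residual (ρ T) (fun r => δ T r ω) t ^ 2 ≤ D T ω * T :=
    fun T hT ω => by
      rw [hDT T hT ω]
      refine ⟨le_mul_of_one_le_left (sum_nonneg fun _ _ => sq_nonneg _) hc₀1, ?_⟩
      exact sum_sq_residual_le (hm T).coeff _ (by omega)
  have hres : ∀ T, ∀ t ∈ Icc (K + 1) T, ∀ ω, residual (ρ T) (fun r => x T r ω) t =
      u T t ω - residual (ρ T) (fun r => δ T r ω) t := fun T t ht ω => by
    rw [hx, residual_sub, (hm T).residual_eq t ht ω]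
  have hS : ∀ j : Fin K, IsLittleOP P (fun T ω => (∑ t ∈ Icc (K + 1) T,
      x T (t - (j + 1)) ω * residual (ρ T) (fun r => x T r ω) t) / T) fun _ => 1 := fun j => by
    refine ((isLittleOP_sum_lag_mul_noise hm hA hs0 hs1 hM hI j).abs.add hE).mono ?_
    filter_upwards [eventually_gt_atTop 0] with T hT ω
    have hT' : (0 : ℝ) < T := by exact_mod_cast hT
    refine le_trans ?_ (le_abs_self _)
    have hlag : ∀ f : ℕ → ℝ, ∑ t ∈ Icc (K + 1) T, f (t - (j + 1)) ^ 2 ≤ ∑ t ∈ Icc 1 T, f t ^ 2 :=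
      fun f => sum_lag_le (f := fun t => f t ^ 2) (fun _ => sq_nonneg _) (by have := j.2; omega)
    have h1 := hpert T hT (Icc (K + 1) T) ω (fun t => e T (t - (j + 1)) ω) (fun t => u T t ω)
      (fun t => δ T (t - (j + 1)) ω) (fun t => residual (ρ T) (fun r => δ T r ω) t)
      ((hlag fun t => e T t ω).trans (hVT T hT ω).1) (hVT T hT ω).2
      ((hlag fun t => δ T t ω).trans (hδT T hT ω).1) (hδT T hT ω).2
    have h2 : ∑ t ∈ Icc (K + 1) T, x T (t - (j + 1)) ω * residual (ρ T) (fun r => x T r ω) t =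
        ∑ t ∈ Icc (K + 1) T, (e T (t - (j + 1)) ω - δ T (t - (j + 1)) ω) *
          (u T t ω - residual (ρ T) (fun r => δ T r ω) t) :=
      sum_congr rfl fun t ht => by rw [hres T t ht ω]
    rw [h2, abs_div, abs_div, abs_of_pos hT', ← div_le_iff₀ hT'] at *
    rw [← sub_le_iff_le_add', ← sub_div]
    refine le_trans ?_ h1
    gcongr
    exact abs_sub_abs_le_abs_sub _ _
  set m : ∀ T, Fin K → ℝ := fun T i =>
    ∑ t ∈ Icc (2 * K + 1) T, ∫ ω', u T (t - (i + 1)) ω' ^ 2 ∂(P T) with hmdef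
  have hW : ∀ i j : Fin K, IsLittleOP P (fun T ω => (∑ t ∈ Icc (2 * K + 1) T,
      residual (ρ T) (fun r => x T r ω) (t - (i + 1)) *
        residual (ρ T) (fun r => x T r ω) (t - (j + 1)) - if i = j then m T i else 0) / T)
      fun _ => 1 := fun i j => by
    refine ((isLittleOP_sum_noise_mul_noise (fun T => (hm T).noise) i j).abs.add hE).mono ?_
    filter_upwards [eventually_gt_atTop 0] with T hT ω
    have hT' : (0 : ℝ) < T := by exact_mod_cast hT
    refine le_trans ?_ (le_abs_self _)
    have hlag : ∀ (l : Fin K) (f : ℕ → ℝ),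
        ∑ t ∈ Icc (2 * K + 1) T, f (t - (l + 1)) ^ 2 ≤ ∑ t ∈ Icc (K + 1) T, f t ^ 2 :=
      fun l f => sum_lag_le (f := fun t => f t ^ 2) (fun _ => sq_nonneg _)
        (by have := l.2; omega)
    have h1 := hpert T hT (Icc (2 * K + 1) T) ω (fun t => u T (t - (i + 1)) ω)
      (fun t => u T (t - (j + 1)) ω)
      (fun t => residual (ρ T) (fun r => δ T r ω) (t - (i + 1)))
      (fun t => residual (ρ T) (fun r => δ T r ω) (t - (j + 1)))
      ((hlag i fun t => u T t ω).trans (hVT T hT ω).2)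
      ((hlag j fun t => u T t ω).trans (hVT T hT ω).2)
      ((hlag i fun t => residual (ρ T) (fun r => δ T r ω) t).trans (hδT T hT ω).2)
      ((hlag j fun t => residual (ρ T) (fun r => δ T r ω) t).trans (hδT T hT ω).2)
    have hidx : ∀ l : Fin K, ∀ t ∈ Icc (2 * K + 1) T, t - (l + 1) ∈ Icc (K + 1) T :=
      fun l t ht => by
        have hl := l.2
        simp only [mem_Icc] at *
        omega
    have h2 : ∑ t ∈ Icc (2 * K + 1) T, residual (ρ T) (fun r => x T r ω) (t - (i + 1)) *
        residual (ρ T) (fun r => x T r ω) (t - (j + 1)) =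
        ∑ t ∈ Icc (2 * K + 1) T,
          (u T (t - (i + 1)) ω - residual (ρ T) (fun r => δ T r ω) (t - (i + 1))) *
          (u T (t - (j + 1)) ω - residual (ρ T) (fun r => δ T r ω) (t - (j + 1))) :=
      sum_congr rfl fun t ht => by
        rw [hres T _ (hidx i t ht) ω, hres T _ (hidx j t ht) ω]
    rw [h2, abs_div, abs_div, abs_of_pos hT', ← div_le_iff₀ hT'] at *
    rw [← sub_le_iff_le_add', ← sub_div]
    refine le_trans ?_ h1
    gcongr
    refine (abs_sub_abs_le_abs_sub _ _).trans (le_of_eq ?_)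
    rw [sub_sub_sub_cancel_right]
  -- All negligible sums are gathered in one variable; on the event that `Z` is small the rest is
  -- deterministic.
  set Z : ∀ T, Ω T → ℝ := fun T ω =>
    (∑ j : Fin K, |(∑ t ∈ Icc (K + 1) T,
      x T (t - (j + 1)) ω * residual (ρ T) (fun r => x T r ω) t) / T|) +
    ∑ i : Fin K, ∑ j : Fin K, |(∑ t ∈ Icc (2 * K + 1) T,
      residual (ρ T) (fun r => x T r ω) (t - (i + 1)) *
        residual (ρ T) (fun r => x T r ω) (t - (j + 1)) - if i = j then m T i else 0) / T| with hZ
  have hZo : IsLittleOP P Z fun _ => 1 := (isLittleOP_sum _ fun j _ => (hS j).abs).add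
    (isLittleOP_sum _ fun i _ => isLittleOP_sum _ fun j _ => (hW i j).abs)
  refine isLittleOP_of_imp (isBoundedInProb_const 0) hZo fun _ _ c hc => ?_
  -- The diagonal means are at least `v / 2 * T`, the entrywise errors cost at most `v / 4 * T`, and
  -- the filter costs the factor `c₀`.
  set l₀ : ℝ := v / (4 * c₀) with hl₀
  have hl₀0 : 0 < l₀ := by positivity
  -- The first bound limits the errors in the Gram matrix, with `K + 1` to allow `K = 0`; the second
  -- makes the squared coefficient error at most `c`.
  refine ⟨min (v / (4 * (K + 1))) (l₀ * √c), by positivity, ?_⟩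
  filter_upwards [eventually_gt_atTop 0, eventually_ge_atTop (4 * K)] with T hT hTK ω _ hZω
  have hT' : (0 : ℝ) < T := by exact_mod_cast hT
  have hS0 : 0 ≤ ∑ j : Fin K, |(∑ t ∈ Icc (K + 1) T,
      x T (t - (j + 1)) ω * residual (ρ T) (fun r => x T r ω) t) / T| :=
    sum_nonneg fun _ _ => abs_nonneg _
  have hW0 : 0 ≤ ∑ i : Fin K, ∑ j : Fin K, |(∑ t ∈ Icc (2 * K + 1) T,
      residual (ρ T) (fun r => x T r ω) (t - (i + 1)) *
        residual (ρ T) (fun r => x T r ω) (t - (j + 1)) - if i = j then m T i else 0) / T| :=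
    sum_nonneg fun _ _ => sum_nonneg fun _ _ => abs_nonneg _
  have hZ1 := (le_abs_self _).trans hZω
  simp only [hZ] at hZ1
  set τ : ℝ := v / (4 * (K + 1)) with hτ
  have hWle : ∀ i j : Fin K, |∑ t ∈ Icc (2 * K + 1) T,
      residual (ρ T) (fun r => x T r ω) (t - (i + 1)) *
        residual (ρ T) (fun r => x T r ω) (t - (j + 1)) - if i = j then m T i else 0| ≤ τ * T :=
    fun i j => by
      rw [← div_le_iff₀ hT', ← abs_of_pos hT', ← abs_div]
      have h1 := single_le_sum (f := fun i : Fin K => ∑ j : Fin K, |(∑ t ∈ Icc (2 * K + 1) T,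
        residual (ρ T) (fun r => x T r ω) (t - (i + 1)) *
          residual (ρ T) (fun r => x T r ω) (t - (j + 1)) - if i = j then m T i else 0) / T|)
        (fun _ _ => sum_nonneg fun _ _ => abs_nonneg _) (mem_univ i)
      have h2 := single_le_sum (f := fun j : Fin K => |(∑ t ∈ Icc (2 * K + 1) T,
        residual (ρ T) (fun r => x T r ω) (t - (i + 1)) *
          residual (ρ T) (fun r => x T r ω) (t - (j + 1)) - if i = j then m T i else 0) / T|)
        (fun _ _ => abs_nonneg _) (mem_univ j)
      have h3 := hZ1.trans (min_le_left _ _)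
      linarith
  -- From `4 * K ≤ T`, the `T - 2 * K` summands number at least `T / 2`.
  have hmle : ∀ i, v / 2 * T ≤ m T i := fun i => by
    have h1 : ∀ t ∈ Icc (2 * K + 1) T, v ≤ ∫ ω', u T (t - (i + 1)) ω' ^ 2 ∂(P T) :=
      fun t ht => hvar T _ (by
        have hi := i.2
        simp only [mem_Icc] at *
        omega)
    refine le_trans ?_ (card_nsmul_le_sum _ _ _ h1)
    rw [nsmul_eq_mul, Nat.card_Icc, (by omega : T + 1 - (2 * K + 1) = T - 2 * K),
      Nat.cast_sub (by omega)]
    have : (4 * K : ℝ) ≤ T := by exact_mod_cast hTK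
    push_cast
    nlinarith
  have hKτ : K * τ ≤ v / 4 := by
    rw [hτ, ← mul_div_assoc, div_le_div_iff₀ (by positivity) (by norm_num)]
    nlinarith
  have hG : ∀ y : Fin K → ℝ, l₀ * T * ∑ i, y i ^ 2 ≤
      ∑ t ∈ Icc (K + 1) T, (lagVec K (fun r => x T r ω) t ⬝ᵥ y) ^ 2 := fun y => by
    have h1 := gram_lower_bound (hm T).coeff (fun r => x T r ω) hmle hWle y
    have h2 : 0 ≤ ∑ i, y i ^ 2 := sum_nonneg fun _ _ => sq_nonneg _
    rw [← hc₀] at h1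
    have h3 : l₀ * T * ∑ i, y i ^ 2 = v / 4 * T * (∑ i, y i ^ 2) / c₀ := by
      rw [hl₀]
      field_simp
    rw [h3, div_le_iff₀ hc₀0, mul_comm _ c₀]
    refine le_trans ?_ h1
    gcongr
    nlinarith
  have hols := sum_sq_olsAR_sub_le (ρ := ρ T) (fun r => x T r ω) (by positivity : 0 < l₀ * T) hG
  rw [abs_of_nonneg (sum_nonneg fun _ _ => sq_nonneg _)]
  refine hols.trans ?_
  have h1 : ∀ i : Fin K, ((∑ t ∈ Icc (K + 1) T, lagVec K (fun r => x T r ω) t i *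
      residual (ρ T) (fun r => x T r ω) t) / (l₀ * T)) ^ 2 = (|(∑ t ∈ Icc (K + 1) T,
      x T (t - (i + 1)) ω * residual (ρ T) (fun r => x T r ω) t) / T| / l₀) ^ 2 := fun i => by
    rw [div_pow |_|, sq_abs, ← div_pow, div_div, mul_comm l₀]
    rfl
  simp_rw [h1, div_pow]
  rw [← sum_div, div_le_iff₀ (by positivity)]
  refine (sum_sq_le_sq_sum_of_nonneg fun i _ => abs_nonneg _).trans ?_
  have h2 := hZ1.trans (min_le_right _ _)
  calc _ ≤ (l₀ * √c) ^ 2 := by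
        gcongr
        linarith
    _ = c * l₀ ^ 2 := by rw [mul_pow, Real.sq_sqrt hc.le, mul_comm]

end Consistency

/-! ### The two parts of the error of the two-stage estimate. -/

section TwoStage

lemma IsBoundedInProb.sub {Ω : ℕ → Type*} [∀ T, MeasurableSpace (Ω T)] {P : ∀ T, Measure (Ω T)}
    {X Y : ∀ T, Ω T → ℝ} (hX : IsBoundedInProb P X) (hY : IsBoundedInProb P Y) :
    IsBoundedInProb P fun T ω => X T ω - Y T ω :=
  isBoundedInProb_of_imp hX hY fun M _ => ⟨M + M, Eventually.of_forall fun _ _ h1 h2 =>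
    (abs_sub _ _).trans (add_le_add h1 h2)⟩

lemma sum_sq_residual_add_le {K T : ℕ} {ρ : Fin K → ℝ} {A : ℝ} (hρ : ∀ j, |ρ j| ≤ A)
    (e δ : ℕ → ℝ) (d : Fin K → ℝ) :
    ∑ t ∈ Icc (K + 1) T, (residual ρ δ t + lagVec K (fun r => e r - δ r) t ⬝ᵥ d) ^ 2 ≤
      4 * (1 + K ^ 2 * A ^ 2) * ∑ t ∈ Icc 1 T, δ t ^ 2 + 4 * K *
        (∑ t ∈ Icc 1 T, e t ^ 2 + ∑ t ∈ Icc 1 T, δ t ^ 2) * ∑ j, d j ^ 2 := by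
  have h1 := sum_sq_residual_le (T := T) hρ δ (a := K + 1) (b := 1) (by omega)
  have h2 := sum_sum_sq_lagVec_le (K := K) (T := T) (fun r => e r - δ r) (a := K + 1) (b := 1)
    (by omega)
  have h3 : ∑ t ∈ Icc 1 T, (e t - δ t) ^ 2 ≤
      2 * (∑ t ∈ Icc 1 T, e t ^ 2 + ∑ t ∈ Icc 1 T, δ t ^ 2) := by
    rw [← sum_add_distrib, mul_sum]
    exact sum_le_sum fun t _ => by nlinarith [sq_nonneg (e t + δ t)]
  have h4 : ∑ t ∈ Icc (K + 1) T, (lagVec K (fun r => e r - δ r) t ⬝ᵥ d) ^ 2 ≤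
      (∑ t ∈ Icc (K + 1) T, ∑ j, lagVec K (fun r => e r - δ r) t j ^ 2) * ∑ j, d j ^ 2 := by
    rw [sum_mul]
    exact sum_le_sum fun t _ => sum_mul_sq_le_sq_mul_sq _ _ _
  have hd : 0 ≤ ∑ j, d j ^ 2 := sum_nonneg fun _ _ => sq_nonneg _
  calc _ ≤ ∑ t ∈ Icc (K + 1) T, (2 * residual ρ δ t ^ 2 +
          2 * (lagVec K (fun r => e r - δ r) t ⬝ᵥ d) ^ 2) := sum_le_sum fun t _ => by
        nlinarith [sq_nonneg (residual ρ δ t - lagVec K (fun r => e r - δ r) t ⬝ᵥ d)]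
    _ = 2 * ∑ t ∈ Icc (K + 1) T, residual ρ δ t ^ 2 +
          2 * ∑ t ∈ Icc (K + 1) T, (lagVec K (fun r => e r - δ r) t ⬝ᵥ d) ^ 2 := by
        rw [sum_add_distrib, mul_sum, mul_sum]
    _ ≤ 2 * (2 * (1 + K ^ 2 * A ^ 2) * ∑ t ∈ Icc 1 T, δ t ^ 2) +
          2 * (K * (2 * (∑ t ∈ Icc 1 T, e t ^ 2 + ∑ t ∈ Icc 1 T, δ t ^ 2)) *
            ∑ j, d j ^ 2) := by
        gcongr
        refine h4.trans ?_
        gcongr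
        exact h2.trans (by gcongr)
    _ = _ := by ring

variable {Ω : ℕ → Type*} [∀ T, MeasurableSpace (Ω T)] {P : ∀ T, Measure (Ω T)}
  {K : ℕ} {e δ : ∀ T, ℕ → Ω T → ℝ} {ρ : ℕ → Fin K → ℝ} {A : ℝ} {d : ∀ T, Ω T → Fin K → ℝ}

lemma isLittleOP_sum_sq_residual_add (hρ : ∀ T j, |ρ T j| ≤ A)
    (he : IsBoundedInProb P fun T ω => (∑ t ∈ Icc 1 T, e T t ω ^ 2) / T)
    (hδ : IsLittleOP P (fun T ω => (∑ t ∈ Icc 1 T, δ T t ω ^ 2) / T) fun _ => 1)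
    (hd : IsLittleOP P (fun T ω => ∑ j, d T ω j ^ 2) fun _ => 1) :
    IsLittleOP P (fun T ω => (∑ t ∈ Icc (K + 1) T, (residual (ρ T) (fun r => δ T r ω) t +
      lagVec K (fun r => e T r ω - δ T r ω) t ⬝ᵥ d T ω) ^ 2) / T) fun _ => 1 := by
  have h1 := (IsBoundedInProb.mul_isLittleOP
    (isBoundedInProb_const (4 * (1 + K ^ 2 * A ^ 2))) hδ).add
    (IsBoundedInProb.mul_isLittleOP ((isBoundedInProb_const (4 * K)).mul
      (he.add hδ.isBoundedInProb)) hd)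
  refine h1.mono (Eventually.of_forall fun T ω => ?_)
  rw [abs_of_nonneg (by positivity)]
  refine le_trans ?_ (le_abs_self _)
  calc _ ≤ _ := div_le_div_of_nonneg_right
        (sum_sq_residual_add_le (hρ T) (fun r => e T r ω) (fun r => δ T r ω) (d T ω))
        (Nat.cast_nonneg T)
    _ = _ := by ring

/-- Finitely many products of a bounded and a negligible factor. Only `δ` at the lags `0, …, K`
enters, which is why pointwise consistency is needed back to `T₀ - K + 1`. -/
lemma isLittleOP_residual_add (hρ : ∀ T j, |ρ T j| ≤ A) {t : ℕ → ℕ}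
    (he : ∀ j : Fin K, IsBoundedInProb P fun T ω => e T (t T - (j + 1)) ω)
    (hδ : ∀ k ≤ K, IsLittleOP P (fun T ω => δ T (t T - k) ω) fun _ => 1)
    (hd : IsLittleOP P (fun T ω => ∑ j, d T ω j ^ 2) fun _ => 1) :
    IsLittleOP P (fun T ω => residual (ρ T) (fun r => δ T r ω) (t T) +
      lagVec K (fun r => e T r ω - δ T r ω) (t T) ⬝ᵥ d T ω) fun _ => 1 := by
  have hdj : ∀ j : Fin K, IsLittleOP P (fun T ω => d T ω j) fun _ => 1 := fun j =>
    IsLittleOP.of_sq (hd.mono (Eventually.of_forall fun T ω => by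
      rw [abs_of_nonneg (sq_nonneg _), abs_of_nonneg (sum_nonneg fun _ _ => sq_nonneg _)]
      exact single_le_sum (f := fun j => d T ω j ^ 2) (fun _ _ => sq_nonneg _) (mem_univ j)))
  have hρO : ∀ j : Fin K, IsBoundedInProb P fun T (_ : Ω T) => -ρ T j := fun j =>
    (isBoundedInProb_const A).mono (Eventually.of_forall fun T _ => by
      rw [abs_neg]
      exact (hρ T j).trans (le_abs_self _))
  have h1 := (hδ 0 (Nat.zero_le K)).add (isLittleOP_sum univ fun j _ =>
    IsBoundedInProb.mul_isLittleOP (hρO j) (hδ (j + 1) j.2))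
  have h2 := isLittleOP_sum univ fun j _ =>
    IsBoundedInProb.mul_isLittleOP ((he j).sub (hδ (j + 1) j.2).isBoundedInProb) (hdj j)
  refine (h1.add h2).mono (Eventually.of_forall fun T ω => le_of_eq ?_)
  congr 1
  simp only [residual, lagVec, dotProduct, Nat.sub_zero, neg_mul, sum_neg_distrib, sub_eq_add_neg,
    mul_comm]

end TwoStage

end FusedAR

/-! ### The theorem. -/

theorem lemma8
    {Ω : ℕ → Type*} [∀ T, MeasurableSpace (Ω T)]
    (P : ∀ T, Measure (Ω T)) [∀ T, IsProbabilityMeasure (P T)]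
    (K : ℕ) (T₀ : ℕ → ℕ) (hT₀ : ∀ᶠ T in atTop, K ≤ T₀ T)
    -- outcomes, first-stage proxies and their estimates, innovations; AR coefficients
    (Y C Chat u : ∀ T, ℕ → Ω T → ℝ) (ρ : ℕ → Fin K → ℝ)
    (hY : ∀ T t, Measurable (Y T t)) (hC : ∀ T t, Measurable (C T t))
    (hChat : ∀ T t, Measurable (Chat T t))
    -- the autoregressive model for the errors `ε_t = Y_t - C_t`
    (hAR : ∀ T, ∀ t ∈ Icc (K + 1) T, ∀ ω, Y T t ω - C T t ω =
      FusedAR.lagVec K (fun s => Y T s ω - C T s ω) t ⬝ᵥ ρ T + u T t ω)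
    -- the errors are stationary, or at least have initial values bounded in probability
    (hinit : (∀ T, FusedAR.IsStationaryUpTo (P T) T (fun t ω => Y T t ω - C T t ω)) ∨
      ∀ t ∈ Icc 1 K, FusedAR.IsBoundedInProb P (fun T ω => Y T t ω - C T t ω))
    -- i.i.d. centered innovations, fourth moments uniformly bounded, uniformly nondegenerate
    (hindep : ∀ T, iIndepFun (fun t : Set.Icc 1 T => u T t) (P T))
    (hident : ∀ T, ∀ t ∈ Icc 1 T, IdentDistrib (u T t) (u T 1) (P T) (P T))
    (hmean : ∀ T, ∀ t ∈ Icc 1 T, ∫ ω, u T t ω ∂(P T) = 0)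
    (hfourth : ∃ M : ℝ, ∀ T, ∀ t ∈ Icc 1 T,
      MemLp (u T t) 4 (P T) ∧ ∫ ω, (u T t ω) ^ 4 ∂(P T) ≤ M)
    (hvar : ∃ v : ℝ, 0 < v ∧ ∀ T, ∀ t ∈ Icc 1 T, v ≤ ∫ ω, (u T t ω) ^ 2 ∂(P T))
    -- the roots lie outside the unit circle, uniformly bounded away from it
    (hroots : ∃ c : ℝ, 0 < c ∧ ∀ T, ∀ z : ℂ,
      1 - ∑ j : Fin K, (ρ T j : ℂ) * z ^ ((j : ℕ) + 1) = 0 → 1 + c ≤ ‖z‖)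
    -- consistency of the first stage: in mean square, and at the times `T₀ - K + 1 ≤ t ≤ T`
    (hms : FusedAR.IsLittleOP P
      (fun T ω => ∑ t ∈ Icc 1 T, (Chat T t ω - C T t ω) ^ 2) (fun T => (T : ℝ)))
    (hpt : ∀ t : ℕ → ℕ, (∀ᶠ T in atTop, T₀ T + 1 ≤ t T + K ∧ t T ≤ T) →
      FusedAR.IsLittleOP P (fun T ω => Chat T (t T) ω - C T (t T) ω) (fun _ => 1)) :
    (∀ t : ℕ → ℕ, (∀ᶠ T in atTop, T₀ T + 1 ≤ t T ∧ t T ≤ T) →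
      FusedAR.IsLittleOP P
        (fun T ω => FusedAR.proxyHat K T (fun s => Y T s ω) (fun s => Chat T s ω) (t T) -
          FusedAR.proxy (fun s => Y T s ω) (fun s => C T s ω) (ρ T) (t T))
        (fun _ => 1)) ∧
    FusedAR.IsLittleOP P
      (fun T ω => ∑ t ∈ Icc (K + 1) T,
        (FusedAR.proxyHat K T (fun s => Y T s ω) (fun s => Chat T s ω) t -
          FusedAR.proxy (fun s => Y T s ω) (fun s => C T s ω) (ρ T) t) ^ 2)
      (fun T => (T : ℝ)) := by
  obtain ⟨M, hM⟩ := hfourth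
  obtain ⟨v, hv, hvar⟩ := hvar
  obtain ⟨c, hc, hroots⟩ := hroots
  obtain ⟨A, s, hA1, hs0, hs1, H⟩ := FusedAR.exists_movingAverage K hc
  have hcoeff := fun T => (H (ρ T) (hroots T)).1
  choose w hw hdec using fun T => (H (ρ T) (hroots T)).2
  have hA : 0 ≤ A := zero_le_one.trans hA1
  have hnoise : ∀ T, FusedAR.IsNoise (P T) T (u T) M := fun T =>
    ⟨hindep T, fun t ht => (hM T t ht).1, hmean T, fun t ht => (hM T t ht).2⟩
  have hM0 : 0 ≤ M := (hnoise 1).nonneg le_rfl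
  set e : ∀ T, ℕ → Ω T → ℝ := fun T t ω => Y T t ω - C T t ω with he
  set δ : ∀ T, ℕ → Ω T → ℝ := fun T t ω => Chat T t ω - C T t ω with hδdef
  have hm : ∀ T, FusedAR.IsStableAR (P T) K T (e T) (u T) (ρ T) (w T) A s M := fun T =>
    { noise := hnoise T
      measurable := fun t => (hY T t).sub (hC T t)
      coeff := hcoeff T
      weight := hw T
      residual_eq := fun t ht ω => by
        rw [FusedAR.residual]
        exact sub_eq_of_eq_add' (hAR T t ht ω)
      approx := fun ω B hB hinit t ht =>
        hdec T T (fun r => e T r ω) (fun r => u T r ω) (fun t ht => hAR T t ht ω) B hB hinit t ht }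
  have hI : FusedAR.IsBoundedInProb P fun T ω => FusedAR.initSum K fun t => e T t ω := by
    rcases hinit with hst | hb
    · exact FusedAR.isBoundedInProb_initSum_of_stationary hm hA hs0.le hs1 hM0 hst
    · exact FusedAR.isBoundedInProb_sum _ fun t ht =>
        (hb t ht).mono (Eventually.of_forall fun T ω => by simp [he])
  -- Both mean square statements are normalized by `T`, so that the calculus for `o_P(1)` applies.
  rw [FusedAR.isLittleOP_natCast_iff] at hms ⊢
  have hd := FusedAR.isLittleOP_sum_sq_olsAR_sub hm hA hs0.le hs1 hM0 hI hv hvar hms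
  have hproxy : ∀ T t ω, FusedAR.proxyHat K T (fun s => Y T s ω) (fun s => Chat T s ω) t -
      FusedAR.proxy (fun s => Y T s ω) (fun s => C T s ω) (ρ T) t =
      FusedAR.residual (ρ T) (fun r => δ T r ω) t +
        FusedAR.lagVec K (fun r => e T r ω - δ T r ω) t ⬝ᵥ
          fun i => FusedAR.olsAR K T (fun t => e T t ω - δ T t ω) i - ρ T i := fun T t ω => by
    simp only [FusedAR.proxyHat_sub_proxy, he, hδdef, sub_sub_sub_cancel_right]
  simp only [hproxy]
  refine ⟨fun t ht => ?_, FusedAR.isLittleOP_sum_sq_residual_add hcoeff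
    (FusedAR.isBoundedInProb_sum_sq hm hA hs0.le hs1 hM0 hI) hms hd⟩
  refine FusedAR.isLittleOP_residual_add hcoeff (fun j => ?_) (fun k hk => ?_) hd
  -- Since `t ≥ T₀ + 1 ≥ K + 1` eventually, all `K` lags fall in `Icc 1 T`.
  · refine FusedAR.isBoundedInProb_apply hm hA hs0.le hs1 hM0 hI ?_
    filter_upwards [ht, hT₀] with T h1 h2
    have hj := j.2
    rw [mem_Icc]
    omega
  · refine hpt (fun T => t T - k) ?_
    filter_upwards [ht, hT₀] with T h1 h2
    omega
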